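/- Let $\eta$ be an irreducible continuous-time Markov chain on a finite or countable set $S$, generated by a conservative infinitesimal matrix $Q=(q(x,y))_{x,y\in S}$ (so $q(x,y)\ge 0$ for $x\ne y$, $-\infty<q(x,x)<0$ and $\sum_y q(x,y)=0$; in case of explosion $\eta$ is the minimal chain), with transition probabilities $p(t;x,y)$. Let $W=\{w_1,\dots,w_N\}\subset S$ be $N$ distinct catalysts. For each $i$ let $\beta_i>0$, $0\le\alpha_i<1$, and let $f_i(s)=\mathsf{E}s^{\xi_i}$, $s\in[0,1]$, be the generating function of a non-negative integer random variable $\xi_i$ with $f_i'(1)<\infty$. A particle at $w_i$ waits there an exponential time with parameter $\beta_i$; then with probability $\alpha_i$ it is replaced by $\xi_i$ particles at $w_i$, and with probability $1-\alpha_i$ it jumps to $y\neq w_i$ with probability proportional to $q(w_i,y)$ and moves on according to $\eta$. Put $W_j=W\setminus\{w_j\}$ and $G_i^*(\lambda)=\int_0^\infty e^{-\lambda t}\beta_ie^{-\beta_i t}\,dt$. Let ${}_{W_j}\overline F^*_{w_i,w_j}(\lambda)$, $\lambda\ge0$, be the Laplace–Stieltjes transform of the (possibly improper) distribution function of the time that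 $\eta$, started at $w_i$, needs after its first exit from $w_i$ to hit $w_j$, this time being $\infty$ if $W_j$ is hit between the exit and the hitting of $w_j$. Let $F^*_{w_i,w_j}(\lambda)$ be the Laplace–Stieltjes transform of the time, counted from time $0$ and without taboo, of the first visit of $\eta$, started at $w_i$, to $w_j$ after its first exit from $w_i$. Let $G_\lambda(x,y)=\int_0^\infty e^{-\lambda t}p(t;x,y)\,dt$ for $\lambda>0$ and $G_0(x,y)=\lim_{\lambda\to0+}G_\lambda(x,y)$. Put $$c_i(\lambda)=\alpha_if_i'(1)G_i^*(\lambda)-1+(1-\alpha_i)G_i^*(\lambda)\,\frac{\lambda-q(w_i,w_i)}{-q(w_i,w_i)}$$ and define $N\times N$ matrices $D(\lambda),\widetilde D(\lambda),\widehat D(\lambda)$ by $$d_{i,j}(\lambda)=\delta_{i,j}\,\alpha_if_i'(1)G_i^*(\lambda)+(1-\alpha_i)G_i^*(\lambda)\,{}_{W_j}\overline F^*_{w_i,w_j}(\lambda),$$ $$\widetilde d_{i,j}(\lambda)=c_i(\lambda)F^*_{w_i,w_j}(\lambda)+\delta_{i,j}\left(\alpha_if_i'(1)G_i^*(\lambda)-1\right)\left(1-F^*_{w_i,w_i}(\lambda)\right),$$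 $$\widehat d_{i,j}(\lambda)=c_i(\lambda)G_\lambda(w_i,w_j)+\delta_{i,j}\,\frac{1-\alpha_i}{q(w_i,w_i)}\,G_i^*(\lambda).$$ (1) For every $\lambda>0$: $\det(D(\lambda)-I)=0$ if and only if $\det\widetilde D(\lambda)=0$, and if and only if $\det\widehat D(\lambda)=0$. (2) If $\eta$ is transient, then the limits $G_0(x,y)$ exist and are finite, and both equivalences of (1) hold for $\lambda=0$ as well. (3) Consequently, if $\nu>0$ is the Malthusian parameter of the process, that is, if the Perron root (the real eigenvalue of maximal modulus) of $D(\nu)$ equals $1$, then $\nu$ is the largest $\lambda>0$ with $\det\widetilde D(\lambda)=0$, and also the largest $\lambda>0$ with $\det\widehat D(\lambda)=0$. -/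

import Mathlib

open MeasureTheory ProbabilityTheory Set Filter Topology
open scoped ENNReal

noncomputable section

/-- A conservative infinitesimal matrix `Q = (q(x,y))` on the state space `S`. -/
structure QMatrix (S : Type*) where
  /-- the entries `q(x,y)` -/
  q : S → S → ℝ
  offDiag_nonneg : ∀ x y, x ≠ y → 0 ≤ q x y
  diag_neg : ∀ x, q x x < 0
  row_sum : ∀ x, HasSum (q x) 0

namespace QMatrix

variable {S : Type*} (Q : QMatrix S)

open scoped Classical in
/-- Probability that the chain, on leaving `x`, jumps to `y`. -/
def jumpProb (x y : S) : ℝ := if y = x then 0 else Q.q x y / (-Q.q x x)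

lemma jumpProb_nonneg (x y : S) : 0 ≤ Q.jumpProb x y := by
  unfold jumpProb
  split_ifs with h
  · exact le_rfl
  · exact div_nonneg (Q.offDiag_nonneg x y (fun e => h e.symm)) (by linarith [Q.diag_neg x])

lemma hasSum_jumpProb (x : S) : HasSum (Q.jumpProb x) 1 := by
  classical
  have h1 := (Q.row_sum x).sub (hasSum_ite_eq x (Q.q x x))
  have h2 := h1.div_const (-Q.q x x)
  have hne : -Q.q x x ≠ 0 := neg_ne_zero.mpr (Q.diag_neg x).ne
  rw [zero_sub, div_self hne] at h2
  have e : Q.jumpProb x = fun y => (Q.q x y - if y = x then Q.q x x else 0) / -Q.q x x := by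
    funext y
    unfold jumpProb
    by_cases h : y = x
    · subst h; simp
    · simp [h]
  rw [e]
  exact h2

/-- Law of the state entered on leaving `x`. -/
def jumpPMF (x : S) : PMF S :=
  ⟨fun y => ENNReal.ofReal (Q.jumpProb x y), by
    have h := Q.hasSum_jumpProb x
    have h1 := ENNReal.ofReal_tsum_of_nonneg (Q.jumpProb_nonneg x) h.summable
    rw [h.tsum_eq, ENNReal.ofReal_one] at h1
    rw [h1]
    exact ENNReal.summable.hasSum⟩

/-- The sample space of the Markov chain: the sequence of successively visited states, and
a sequence of standard exponential clocks. -/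
abbrev Path (S : Type*) : Type _ := (ℕ → S) × (ℕ → ℝ)

/-- The time spent in the `k`-th visited state `x`: an exponential variable of rate `-q(x,x)`. -/
def holdingTime (k : ℕ) (ω : Path S) : ℝ := ω.2 k / (-Q.q (ω.1 k) (ω.1 k))

/-- The time of the `n`-th jump; `jumpTime 0 = 0`. -/
def jumpTime (n : ℕ) (ω : Path S) : ℝ := ∑ k ∈ Finset.range n, Q.holdingTime k ω

/-- The event `η(t) = y`: at time `t` the chain is in the state `y`. -/
def stateEvent (t : ℝ) (y : S) : Set (Path S) :=
  {ω | ∃ n, Q.jumpTime n ω ≤ t ∧ t < Q.jumpTime (n + 1) ω ∧ ω.1 n = y}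

/-- After the first exit out of the starting state, the first visit to `y` takes place at the
`n`-th jump, and the states visited strictly between the start and this visit avoid `H`. -/
def IsFirstHit (H : Set S) (y : S) (ω : Path S) (n : ℕ) : Prop :=
  1 ≤ n ∧ ω.1 n = y ∧ ∀ m, 1 ≤ m → m < n → ω.1 m ≠ y ∧ ω.1 m ∉ H

/-- Hitting time of `y` under taboo `H` after the first exit out of the starting state, counted
from this exit; it is `∞` if `y` is not reached, or not reached before `H`. -/
def exitHittingTime (H : Set S) (y : S) (ω : Path S) : ℝ≥0∞ :=
  ⨅ (n : ℕ) (_ : IsFirstHit H y ω n), ENNReal.ofReal (Q.jumpTime n ω - Q.jumpTime 1 ω)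

/-- The same hitting time, counted from time `0`. -/
def hittingTime (H : Set S) (y : S) (ω : Path S) : ℝ≥0∞ :=
  ⨅ (n : ℕ) (_ : IsFirstHit H y ω n), ENNReal.ofReal (Q.jumpTime n ω)

variable [Countable S] [MeasurableSpace S] [DiscreteMeasurableSpace S]

/-- The transition kernel of the embedded jump chain. -/
def jumpKernel : Kernel S S := Kernel.ofFunOfCountable fun x => (Q.jumpPMF x).toMeasure

instance : IsMarkovKernel Q.jumpKernel :=
  ⟨fun x => PMF.toMeasure.isProbabilityMeasure (Q.jumpPMF x)⟩

/-- The law of the embedded jump chain started at `x`. -/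
def jumpChainLaw (x : S) : Measure (ℕ → S) :=
  Kernel.trajMeasure (X := fun _ => S) (Measure.dirac x)
    (fun n => Q.jumpKernel.comap (fun y : (i : Finset.Iic n) → S => y ⟨n, by simp⟩)
      (measurable_pi_apply _))

/-- The law `P_x` of the continuous-time Markov chain `η` generated by `Q` and started at `x`
(the minimal chain, which is the only one when there is no explosion): given the visited states,
the times spent in them are independent and exponential. -/
def law (x : S) : Measure (Path S) :=
  (Q.jumpChainLaw x).prod (Measure.infinitePi fun _ : ℕ => expMeasure 1)

/-- The transition probability `p(t;x,y) = P_x(η(t) = y)`. -/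
def transProb (t : ℝ) (x y : S) : ℝ := (Q.law x).real (Q.stateEvent t y)

/-- The chain is irreducible: any state can be reached from any other one. -/
def Irreducible : Prop := ∀ x y, ∃ t > 0, 0 < Q.transProb t x y

/-- The chain is transient: from every state, the return to it has probability less than one. -/
def Transient : Prop := ∀ x, Q.law x {ω | Q.hittingTime ∅ x ω < ∞} < 1

open scoped Classical in
/-- `G_lam(x,y)`: for `lam > 0` the Laplace transform of the transition probability, for `lam = 0`
(the Green function) its limit as `lam → 0+`. -/
def green (lam : ℝ) (x y : S) : ℝ :=
  if 0 < lam then ∫ t in Ioi (0 : ℝ), Real.exp (-(lam * t)) * Q.transProb t x y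
  else limUnder (𝓝[>] (0 : ℝ)) fun r => ∫ t in Ioi (0 : ℝ), Real.exp (-(r * t)) * Q.transProb t x y

end QMatrix

/-- The measure `dF` on the line, where `F(t) = P(τ ≤ t)` is the (possibly improper) distribution
function of the extended random variable `τ`. -/
def improperLaw {Ω : Type*} [MeasurableSpace Ω] (P : Measure Ω) (τ : Ω → ℝ≥0∞) : Measure ℝ :=
  (P.restrict {ω | τ ω < ∞}).map fun ω => (τ ω).toReal

/-- The Laplace-Stieltjes transform `∫ e^{-lam t} dF(t)`. -/
def laplaceStieltjes (dF : Measure ℝ) (lam : ℝ) : ℝ := ∫ t, Real.exp (-(lam * t)) ∂dF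

/-- The data of a catalytic branching process on `S` with the catalysts `w_1, …, w_N`. -/
structure CBP (S : Type*) (N : ℕ) where
  /-- the generator of the motion `η` -/
  Q : QMatrix S
  /-- the catalysts -/
  w : Fin N → S
  w_injective : Function.Injective w
  /-- the rate of the exponential time spent at a catalyst -/
  β : Fin N → ℝ
  β_pos : ∀ i, 0 < β i
  /-- the probability of branching at a catalyst -/
  α : Fin N → ℝ
  α_nonneg : ∀ i, 0 ≤ α i
  α_lt_one : ∀ i, α i < 1
  /-- the law of the number of offspring at a catalyst -/
  ξ : Fin N → PMF ℕ
  /-- the offspring generating functions have a finite derivative at `1` -/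
  differentiable_pgf : ∀ i,
    DifferentiableWithinAt ℝ (fun s : ℝ => ∑' n, (ξ i n).toReal * s ^ n) (Icc 0 1) 1

namespace CBP

variable {S : Type*} {N : ℕ} (C : CBP S N)

/-- The offspring generating function `f_i(s)`, `0 ≤ s ≤ 1`. -/
def pgf (i : Fin N) (s : ℝ) : ℝ := ∑' n, (C.ξ i n).toReal * s ^ n

/-- `f_i'(1)`. -/
def meanOffspring (i : Fin N) : ℝ := derivWithin (C.pgf i) (Icc 0 1) 1

/-- `G_i^*(lam)`, with `G_i` the exponential distribution of rate `β_i`. -/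
def Gstar (i : Fin N) (lam : ℝ) : ℝ := laplaceStieltjes (expMeasure (C.β i)) lam

/-- The taboo set `W_j`: all catalysts except `w_j`. -/
def tabooSet (j : Fin N) : Set S := range C.w \ {C.w j}

variable [Countable S] [MeasurableSpace S] [DiscreteMeasurableSpace S]

/-- The Laplace-Stieltjes transform of the hitting time of `w_j` under taboo `W_j` after the first
exit out of the starting state `w_i`. -/
def tabooFbarStar (i j : Fin N) (lam : ℝ) : ℝ :=
  laplaceStieltjes
    (improperLaw (C.Q.law (C.w i)) (C.Q.exitHittingTime (C.tabooSet j) (C.w j))) lam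

/-- The Laplace-Stieltjes transform of the hitting time of `w_j` (without taboo, counted from time
`0`) for the chain started at `w_i`; for `i = j` it is the time of the first return. -/
def Fstar (i j : Fin N) (lam : ℝ) : ℝ :=
  laplaceStieltjes (improperLaw (C.Q.law (C.w i)) (C.Q.hittingTime ∅ (C.w j))) lam

/-- The matrix `D(lam)`. -/
def D (lam : ℝ) : Matrix (Fin N) (Fin N) ℝ := Matrix.of fun i j =>
  (if i = j then C.α i * C.meanOffspring i * C.Gstar i lam else 0)
    + (1 - C.α i) * C.Gstar i lam * C.tabooFbarStar i j lam

/-- The common factor in the entries of `Dtilde` and `Dhat`. -/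
def rowCoeff (i : Fin N) (lam : ℝ) : ℝ :=
  C.α i * C.meanOffspring i * C.Gstar i lam - 1
    + (1 - C.α i) * C.Gstar i lam
      * ((lam - C.Q.q (C.w i) (C.w i)) / (-C.Q.q (C.w i) (C.w i)))

/-- The matrix with entries in terms of hitting times without taboo. -/
def Dtilde (lam : ℝ) : Matrix (Fin N) (Fin N) ℝ := Matrix.of fun i j =>
  C.rowCoeff i lam * C.Fstar i j lam
    + (if i = j then (C.α i * C.meanOffspring i * C.Gstar i lam - 1) * (1 - C.Fstar i i lam)
        else 0)

/-- The matrix with entries in terms of the Green function. -/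
def Dhat (lam : ℝ) : Matrix (Fin N) (Fin N) ℝ := Matrix.of fun i j =>
  C.rowCoeff i lam * C.Q.green lam (C.w i) (C.w j)
    + (if i = j then (1 - C.α i) / C.Q.q (C.w i) (C.w i) * C.Gstar i lam else 0)

end CBP

/-- `ρ` is the Perron root of the real matrix `A`: a real eigenvalue of maximal modulus among all
complex eigenvalues. -/
def IsPerronRoot {N : ℕ} (A : Matrix (Fin N) (Fin N) ℝ) (ρ : ℝ) : Prop :=
  Module.End.HasEigenvalue (Matrix.toLin' A) ρ ∧
    ∀ μ : ℂ, Module.End.HasEigenvalue (Matrix.toLin' (A.map (algebraMap ℝ ℂ))) μ → ‖μ‖ ≤ ρ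

/-- `ν` is the Malthusian parameter of a catalytic branching process: the positive solution of
`ρ(D(ν)) = 1`, where `ρ` is the Perron root. -/
def CBP.IsMalthusian {S : Type*} [Countable S] [MeasurableSpace S] [DiscreteMeasurableSpace S]
    {N : ℕ} (C : CBP S N) (ν : ℝ) : Prop :=
  0 < ν ∧ IsPerronRoot (C.D ν) 1

end

/-! All three matrices are tied together by the Green matrix `G = (G_lam(w_i,w_j))`. Cutting a path
at its first entrance into `W` after the first exit, or only at its first visit to `w_j`, gives two
linear relations: `G` equals a diagonal matrix with entries `1/(q_i+lam)`, where `q_i =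
-q(w_i,w_i)`, plus `diag(q_i/(q_i+lam)) T G`, with `T` the taboo transforms; and `G_ij =
δ_ij/(q_j+lam) + F_ij G_jj`. The first makes `G` invertible and gives `(D - I) G = Dhat`; the second
makes every `G_jj` nonzero and gives `Dtilde diag(G_jj) = Dhat`. Taking determinants proves both
equivalences (`det_eq_zero_iff_of_firstEntrance`).

Both relations are instances of one identity for sums over paths of the jump chain weighted by
`rate/(rate+lam)` (`pathSum_eq_indicator_add_sum`). Integrating out the exponential clocks turns
Green functions and hitting transforms into such sums (`lintegral_exp_mul_law_stateEvent`,
`lintegral_discountFactor_iInf`). This is done in `[0,∞]`, for all `lam ≥ 0`; the passage to real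
numbers needs only finiteness of the Green function, automatic for `lam > 0` and a consequence of
transience at `lam = 0`.

For the Malthusian parameter, each row of `D` contains the strictly decreasing factor
`β_i/(β_i+lam)`, and the remaining factors do not increase. Hence `D(lam) ≤ κ D(ν)` entrywise with
`κ < 1` when `lam > ν`, and Gelfand's formula excludes the eigenvalue `1` for `D(lam)`. -/

namespace QMatrix

/-! ### Markov property of the embedded jump chain. -/

section JumpChain

variable {S : Type*} [Countable S] [MeasurableSpace S] [DiscreteMeasurableSpace S] (Q : QMatrix S)

/-- The one-step transition operator of the jump chain. -/
noncomputable def stepOp (f : S → ℝ≥0∞) (x : S) : ℝ≥0∞ := ∫⁻ y, f y ∂Q.jumpKernel x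

/-- The one-step transition operator followed by multiplication by `a`. -/
noncomputable def weightedStep (a f : S → ℝ≥0∞) (x : S) : ℝ≥0∞ := a x * Q.stepOp f x

instance (x : S) : IsProbabilityMeasure (Q.jumpChainLaw x) := by
  unfold jumpChainLaw; infer_instance

lemma lintegral_jumpChainLaw_zero (x : S) (f : S → ℝ≥0∞) :
    ∫⁻ ω, f (ω 0) ∂Q.jumpChainLaw x = f x := by
  have hm : (Q.jumpChainLaw x).map (Preorder.frestrictLe (π := fun _ : ℕ => S) 0)
      = (Measure.dirac x).map (MeasurableEquiv.piUnique (fun _ : Finset.Iic 0 => S)).symm := by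
    unfold jumpChainLaw Kernel.trajMeasure
    rw [Measure.map_comp _ _ (by fun_prop), Kernel.traj_map_frestrictLe, Kernel.partialTraj_self,
      Measure.id_comp]
  have h1 : ∫⁻ ω, f (ω 0) ∂Q.jumpChainLaw x
      = ∫⁻ z, f (z ⟨0, by simp⟩) ∂(Q.jumpChainLaw x).map
        (Preorder.frestrictLe (π := fun _ : ℕ => S) 0) := by
    rw [lintegral_map]
    · rfl
    · exact (Measurable.of_discrete (f := f)).comp (measurable_pi_apply _)
    · fun_prop
  rw [h1, hm, lintegral_map, lintegral_dirac']
  · rfl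
  · exact (Measurable.of_discrete (f := _))
  · exact (Measurable.of_discrete (f := f)).comp (measurable_pi_apply _)
  · exact MeasurableEquiv.measurable _

/-- Markov property at step `n`: the trajectory measure extends the law of the first coordinates by
the kernel, which looks only at the current state. -/
lemma lintegral_jumpChainLaw_succ (x : S) (n : ℕ) (Φ : ((i : Finset.Iic n) → S) → ℝ≥0∞)
    (hΦ : Measurable Φ) (b : S → ℝ≥0∞) :
    ∫⁻ ω, Φ (Preorder.frestrictLe (π := fun _ : ℕ => S) n ω) * b (ω (n + 1)) ∂Q.jumpChainLaw x
      = ∫⁻ ω, Φ (Preorder.frestrictLe (π := fun _ : ℕ => S) n ω) * Q.stepOp b (ω n)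
        ∂Q.jumpChainLaw x := by
  have hb := Measurable.of_discrete (f := b)
  have hm := Kernel.map_frestrictLe_trajMeasure_compProd_eq_map_trajMeasure
    (X := fun _ => S) (μ₀ := Measure.dirac x)
    (κ := fun n => Q.jumpKernel.comap (fun y : (i : Finset.Iic n) → S => y ⟨n, by simp⟩)
      (measurable_pi_apply _)) (a := n)
  have hF : Measurable fun p : ((i : Finset.Iic n) → S) × S => Φ p.1 * b p.2 := by fun_prop
  have h1 := congrArg (fun μ => ∫⁻ p, Φ p.1 * b p.2 ∂μ) hm
  rw [Measure.lintegral_compProd hF, lintegral_map hF (by fun_prop)] at h1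
  unfold jumpChainLaw
  rw [← h1, lintegral_map]
  · refine lintegral_congr fun ω => ?_
    rw [Kernel.comap_apply, stepOp]
    exact lintegral_const_mul (Φ (Preorder.frestrictLe (π := fun _ : ℕ => S) n ω)) hb
  · exact hF.lintegral_kernel_prod_right'
  · fun_prop

/-- The Markov property, for functionals of product form of the jump chain. -/
lemma lintegral_jumpChainLaw_prod (x : S) (a₀ a : S → ℝ≥0∞) (n : ℕ) (b : S → ℝ≥0∞) :
    ∫⁻ ω, (a₀ (ω 0) * ∏ m ∈ Finset.range n, a (ω (m + 1))) * b (ω (n + 1)) ∂Q.jumpChainLaw x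
      = a₀ x * Q.stepOp ((Q.weightedStep a)^[n] b) x := by
  have ha₀ := Measurable.of_discrete (f := a₀)
  have ha := Measurable.of_discrete (f := a)
  have key : ∀ (n : ℕ) (b : S → ℝ≥0∞),
      ∫⁻ ω, (a₀ (ω 0) * ∏ m ∈ Finset.range n, a (ω (m + 1))) * b (ω (n + 1)) ∂Q.jumpChainLaw x
        = ∫⁻ ω, (a₀ (ω 0) * ∏ m ∈ Finset.range n, a (ω (m + 1))) * Q.stepOp b (ω n)
          ∂Q.jumpChainLaw x := by
    intro n b
    have h := Q.lintegral_jumpChainLaw_succ x n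
      (fun z => a₀ (z ⟨0, by simp⟩) * ∏ m : Fin n, a (z ⟨m + 1, by simp⟩))
      (by fun_prop) b
    simpa only [Finset.prod_range, Preorder.frestrictLe_apply] using h
  induction n generalizing b with
  | zero =>
    rw [key]
    simp only [Finset.range_zero, Finset.prod_empty, mul_one, Function.iterate_zero, id]
    exact Q.lintegral_jumpChainLaw_zero x (fun z => a₀ z * Q.stepOp b z)
  | succ n ih =>
    -- Integrating out the last coordinate merges the last weight with `stepOp b` into `weightedStep
    -- a b`, which takes the place of `b` in the induction hypothesis.
    rw [key, Function.iterate_succ_apply, ← ih]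
    refine lintegral_congr fun ω => ?_
    rw [Finset.prod_range_succ, weightedStep]
    ring

end JumpChain

/-! ### Path sums and their first-entrance decomposition. -/

section Resolvent

variable {S : Type*} [Countable S] [MeasurableSpace S] [DiscreteMeasurableSpace S] (Q : QMatrix S)

lemma stepOp_tsum {ι : Type*} [Countable ι] (f : ι → S → ℝ≥0∞) (x : S) :
    Q.stepOp (fun z => ∑' i, f i z) x = ∑' i, Q.stepOp (f i) x :=
  lintegral_tsum fun i => (Measurable.of_discrete (f := f i)).aemeasurable

lemma stepOp_const_mul (c : ℝ≥0∞) (f : S → ℝ≥0∞) (x : S) :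
    Q.stepOp (fun z => c * f z) x = c * Q.stepOp f x :=
  lintegral_const_mul _ (Measurable.of_discrete (f := f))

lemma weightedStep_tsum {ι : Type*} [Countable ι] (a : S → ℝ≥0∞) (f : ι → S → ℝ≥0∞) :
    Q.weightedStep a (fun z => ∑' i, f i z) = fun z => ∑' i, Q.weightedStep a (f i) z := by
  funext z
  simp only [weightedStep, stepOp_tsum, ENNReal.tsum_mul_left]

lemma weightedStep_const_mul (a : S → ℝ≥0∞) (c : ℝ≥0∞) (f : S → ℝ≥0∞) :
    Q.weightedStep a (fun z => c * f z) = fun z => c * Q.weightedStep a f z := by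
  funext z
  simp only [weightedStep, stepOp_const_mul]
  ring

lemma iterate_weightedStep_tsum {ι : Type*} [Countable ι] (a : S → ℝ≥0∞) (n : ℕ)
    (f : ι → S → ℝ≥0∞) :
    (Q.weightedStep a)^[n] (fun z => ∑' i, f i z)
      = fun z => ∑' i, (Q.weightedStep a)^[n] (f i) z := by
  induction n generalizing f with
  | zero => rfl
  | succ n ih => simp only [Function.iterate_succ_apply, weightedStep_tsum, ih]

lemma iterate_weightedStep_const_mul (a : S → ℝ≥0∞) (n : ℕ) (c : ℝ≥0∞) (f : S → ℝ≥0∞) :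
    (Q.weightedStep a)^[n] (fun z => c * f z)
      = fun z => c * (Q.weightedStep a)^[n] f z := by
  induction n generalizing f with
  | zero => rfl
  | succ n ih => simp only [Function.iterate_succ_apply, weightedStep_const_mul, ih]

/-- The sum over all paths from `x` to `y` of the product of the weights `a` along the path,
the endpoint excluded. -/
noncomputable def pathSum (a : S → ℝ≥0∞) (x y : S) : ℝ≥0∞ :=
  ∑' n, (Q.weightedStep a)^[n] (({y} : Set S).indicator 1) x

/-- The sum over all nontrivial paths from `x` to `y` of the product of the weights `a` along the
path, both endpoints excluded. -/
noncomputable def innerPathSum (a : S → ℝ≥0∞) (x y : S) : ℝ≥0∞ :=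
  ∑' n, Q.stepOp ((Q.weightedStep a)^[n] (({y} : Set S).indicator 1)) x

lemma innerPathSum_eq_stepOp (a : S → ℝ≥0∞) (x y : S) :
    Q.innerPathSum a x y = Q.stepOp (fun z => Q.pathSum a z y) x :=
  (Q.stepOp_tsum _ x).symm

lemma pathSum_eq_add (a : S → ℝ≥0∞) (x y : S) :
    Q.pathSum a x y = ({y} : Set S).indicator 1 x + a x * Q.innerPathSum a x y := by
  rw [pathSum, tsum_eq_zero_add' ENNReal.summable, innerPathSum, ← ENNReal.tsum_mul_left]
  simp only [Function.iterate_succ_apply', Function.iterate_zero, id]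
  rfl

lemma tsum_prod_eq_tsum_sum_antidiagonal (f : ℕ → ℕ → ℝ≥0∞) :
    ∑' k, ∑' l, f k l = ∑' n, ∑ p ∈ Finset.HasAntidiagonal.antidiagonal n, f p.1 p.2 := by
  rw [← ENNReal.tsum_prod, ← Finset.HasAntidiagonal.sigmaAntidiagonalEquivProd.tsum_eq, ENNReal.tsum_sigma']
  refine tsum_congr fun n => ?_
  rw [tsum_fintype, Finset.univ_eq_attach]
  exact Finset.sum_attach (Finset.HasAntidiagonal.antidiagonal n) fun p => f p.1 p.2

/-- Decomposition of an iterate according to the first visit to `A`. -/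
lemma iterate_weightedStep_eq_sum (a : S → ℝ≥0∞) (A : Set S) {y : S} (hy : y ∈ A) (n : ℕ) :
    (Q.weightedStep a)^[n] (({y} : Set S).indicator 1)
      = ∑ p ∈ Finset.HasAntidiagonal.antidiagonal n, (Q.weightedStep (Aᶜ.indicator a))^[p.1]
          (A.indicator ((Q.weightedStep a)^[p.2] (({y} : Set S).indicator 1))) := by
  have hadd : ∀ {ι : Type} (s : Finset ι) (f : ι → S → ℝ≥0∞) (c : S → ℝ≥0∞),
      Q.weightedStep c (∑ i ∈ s, f i) = ∑ i ∈ s, Q.weightedStep c (f i) := by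
    intro ι s f c
    funext z
    simp only [weightedStep, stepOp, Finset.sum_apply]
    rw [lintegral_finsetSum _ fun i _ => Measurable.of_discrete (f := f i), Finset.mul_sum]
  induction n with
  | zero =>
    simp only [Function.iterate_zero, id, Finset.Nat.antidiagonal_zero, Finset.sum_singleton]
    rw [Set.indicator_indicator, Set.inter_eq_right.mpr (by simpa using hy)]
  | succ n ih =>
    rw [Finset.Nat.sum_antidiagonal_succ]
    simp only [Function.iterate_succ_apply']
    rw [← hadd, ← ih]
    funext z
    simp only [Function.iterate_zero, id, Pi.add_apply]
    -- On `A` the killed weight vanishes, leaving the term that stops at once; off `A` that term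
    -- vanishes and the weights agree.
    by_cases hz : z ∈ A <;> simp [hz, weightedStep]

/-- A path ending at `w j` has a first point `w k` in the range of `w`. The part before it sees only
weights outside the range, hence the killed weights; the endpoint carries no weight, so the two
parts multiply without overlap. An `x` in the range is its own entrance point. -/
lemma pathSum_eq_sum {ι : Type*} [Fintype ι] (a : S → ℝ≥0∞) (w : ι → S)
    (hw : Function.Injective w) (x : S) (j : ι) :
    Q.pathSum a x (w j)
      = ∑ k, Q.pathSum ((range w)ᶜ.indicator a) x (w k) * Q.pathSum a (w k) (w j) := by
  have hind : ∀ g : S → ℝ≥0∞, (range w).indicator g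
      = fun z => ∑' k, g (w k) * ({w k} : Set S).indicator 1 z := by
    intro g
    funext z
    rw [tsum_fintype]
    by_cases hz : z ∈ range w
    · obtain ⟨k, rfl⟩ := hz
      rw [Finset.sum_eq_single k]
      · simp
      · intro l _ hl
        simp [hw.ne hl.symm]
      · simp
    · rw [Set.indicator_of_notMem hz, Finset.sum_eq_zero]
      intro k _
      have : z ≠ w k := fun h => hz ⟨k, h.symm⟩
      simp [this]
  have h1 : Q.pathSum a x (w j) = ∑' k, ∑' l, (Q.weightedStep ((range w)ᶜ.indicator a))^[k]
      ((range w).indicator ((Q.weightedStep a)^[l] (({w j} : Set S).indicator 1))) x := by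
    rw [tsum_prod_eq_tsum_sum_antidiagonal, pathSum]
    refine tsum_congr fun n => ?_
    rw [Q.iterate_weightedStep_eq_sum a (range w) (mem_range_self j) n, Finset.sum_apply]
  rw [h1]
  simp only [hind, iterate_weightedStep_tsum, iterate_weightedStep_const_mul]
  simp only [pathSum, ← ENNReal.tsum_mul_right, ← ENNReal.tsum_mul_left, ← tsum_fintype (L := SummationFilter.unconditional _)]
  rw [ENNReal.tsum_comm]
  have : ∀ l : ℕ, ∑' k : ℕ, ∑' i : ι, (Q.weightedStep a)^[l] (({w j} : Set S).indicator 1) (w i) *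
      (Q.weightedStep ((range w)ᶜ.indicator a))^[k] (({w i} : Set S).indicator 1) x
      = ∑' i : ι, ∑' k : ℕ, (Q.weightedStep a)^[l] (({w j} : Set S).indicator 1) (w i) *
      (Q.weightedStep ((range w)ᶜ.indicator a))^[k] (({w i} : Set S).indicator 1) x :=
    fun l => ENNReal.tsum_comm
  simp only [this]
  rw [ENNReal.tsum_comm]
  refine tsum_congr fun i => ?_
  refine tsum_congr fun l => tsum_congr fun k => ?_
  ring

/-- First-entrance decomposition of the path sums with respect to a finite set of states. -/
lemma pathSum_eq_indicator_add_sum {ι : Type*} [Fintype ι] (a : S → ℝ≥0∞) (w : ι → S)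
    (hw : Function.Injective w) (x : S) (j : ι) :
    Q.pathSum a x (w j) = ({w j} : Set S).indicator 1 x
      + a x * ∑ k, Q.innerPathSum ((range w)ᶜ.indicator a) x (w k)
        * Q.pathSum a (w k) (w j) := by
  rw [pathSum_eq_add, innerPathSum_eq_stepOp]
  congr 2
  -- The decomposition is applied at the state reached after one jump, so an entrance is counted
  -- only after the exit from `x`, even when `x` is in the range.
  rw [funext fun z => Q.pathSum_eq_sum a w hw z j]
  simp only [← tsum_fintype (L := SummationFilter.unconditional _)]
  rw [stepOp_tsum]
  refine tsum_congr fun k => ?_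
  rw [innerPathSum_eq_stepOp, mul_comm, ← stepOp_const_mul]
  exact congrArg (Q.stepOp · x) (funext fun z => mul_comm _ _)

end Resolvent

end QMatrix

/-! ### Integrals against independent exponential clocks. -/

section Exponential

lemma expMeasure_eq_withDensity (q : ℝ) :
    expMeasure q = volume.withDensity (exponentialPDF q) := rfl

lemma measurable_exponentialPDF (q : ℝ) : Measurable (exponentialPDF q) :=
  (measurable_exponentialPDFReal q).ennreal_ofReal

/-- Tilting the density of rate `q` by `e^{-lam t}` gives `q/(q+lam)` times the density of rate
`q+lam`. -/
lemma lintegral_exp_expMeasure {q lam : ℝ} (hq : 0 < q) (hlam : 0 ≤ lam) :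
    ∫⁻ t, ENNReal.ofReal (Real.exp (-(lam * t))) ∂expMeasure q = ENNReal.ofReal (q / (q + lam)) := by
  rw [expMeasure_eq_withDensity,
    lintegral_withDensity_eq_lintegral_mul _ (measurable_exponentialPDF q) (by fun_prop)]
  have h : ∀ t, (exponentialPDF q * fun t => ENNReal.ofReal (Real.exp (-(lam * t)))) t
      = ENNReal.ofReal (q / (q + lam)) * exponentialPDF (q + lam) t := by
    intro t
    simp only [Pi.mul_apply, exponentialPDF_eq]
    split_ifs with ht
    · rw [← ENNReal.ofReal_mul (by positivity), ← ENNReal.ofReal_mul (by positivity), mul_assoc,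
        ← Real.exp_add, ← mul_assoc, div_mul_cancel₀ _ (by positivity)]
      ring_nf
    · simp
  simp only [h]
  rw [lintegral_const_mul _ (measurable_exponentialPDF _),
    lintegral_exponentialPDF_eq_one (by positivity), mul_one]

lemma lintegral_exp_div_expMeasure_one {q l : ℝ} (hq : 0 < q) (hl : 0 ≤ l) :
    ∫⁻ e, ENNReal.ofReal (Real.exp (-(l * (e / q)))) ∂expMeasure 1 = ENNReal.ofReal (q / (q + l)) := by
  have h := lintegral_exp_expMeasure one_pos (div_nonneg hl hq.le)
  have e1 : 1 / (1 + l / q) = q / (q + l) := by field_simp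
  rw [← e1, ← h]
  refine lintegral_congr fun e => ?_
  congr 3
  ring

lemma expMeasure_one_Ioi {u : ℝ} (hu : 0 ≤ u) :
    expMeasure 1 (Ioi u) = ENNReal.ofReal (Real.exp (-u)) := by
  have := isProbabilityMeasure_expMeasure one_pos
  have h1 : (expMeasure 1).real (Iic u) = 1 - Real.exp (-u) := by
    rw [← cdf_eq_real, cdf_expMeasure_eq one_pos, if_pos hu, one_mul]
  have h2 : (expMeasure 1).real (Ioi u) = Real.exp (-u) := by
    rw [← compl_Iic, probReal_compl_eq_one_sub measurableSet_Iic, h1]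
    ring
  rw [← h2, ofReal_measureReal]

lemma lintegral_Ici_exp_neg {c : ℝ} (hc : 0 < c) :
    ∫⁻ s in Ici 0, ENNReal.ofReal (Real.exp (-(c * s))) = ENNReal.ofReal (1 / c) := by
  have h := lintegral_exponentialPDF_eq_one hc
  have h2 : ∀ s, exponentialPDF c s
      = (Ici 0).indicator (fun s => ENNReal.ofReal c * ENNReal.ofReal (Real.exp (-(c * s)))) s := by
    intro s
    rw [exponentialPDF_eq, indicator_apply]
    simp only [mem_Ici]
    split_ifs
    · rw [ENNReal.ofReal_mul hc.le]
    · simp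
  simp only [h2] at h
  rw [lintegral_indicator measurableSet_Ici, lintegral_const_mul _ (by fun_prop)] at h
  rw [one_div, ENNReal.ofReal_inv_of_pos hc]
  exact ENNReal.eq_inv_of_mul_eq_one_left (by rwa [mul_comm])

/-- The discounted expected time spent in a state of rate `q`. -/
lemma lintegral_discounted_sojourn {q lam : ℝ} (hq : 0 < q) (hlam : 0 ≤ lam) :
    ∫⁻ e, (∫⁻ s in Ici 0, ENNReal.ofReal (Real.exp (-(lam * s))) * (Iio (e / q)).indicator 1 s)
      ∂expMeasure 1 = ENNReal.ofReal (1 / (q + lam)) := by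
  have := isProbabilityMeasure_expMeasure one_pos
  have hmeas : Measurable (Function.uncurry fun (e s : ℝ) =>
      ENNReal.ofReal (Real.exp (-(lam * s))) * (Iio (e / q)).indicator (1 : ℝ → ℝ≥0∞) s) := by
    refine Measurable.mul (by fun_prop) ?_
    have : (fun p : ℝ × ℝ => (Iio (p.1 / q)).indicator (1 : ℝ → ℝ≥0∞) p.2)
        = {p : ℝ × ℝ | p.2 < p.1 / q}.indicator 1 := by
      funext p; simp [indicator_apply]
    exact this ▸ measurable_one.indicator (measurableSet_lt (by fun_prop) (by fun_prop))
  rw [lintegral_lintegral_swap hmeas.aemeasurable, ← lintegral_Ici_exp_neg (by positivity)]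
  refine setLIntegral_congr_fun measurableSet_Ici fun s hs => ?_
  have h1 : ∀ e : ℝ, (Iio (e / q)).indicator (1 : ℝ → ℝ≥0∞) s = (Ioi (s * q)).indicator 1 e := by
    intro e
    simp [indicator_apply, lt_div_iff₀ hq]
  simp only [h1]
  rw [lintegral_const_mul _ (measurable_one.indicator measurableSet_Ioi),
    lintegral_indicator_one measurableSet_Ioi, expMeasure_one_Ioi (mul_nonneg hs hq.le),
    ← ENNReal.ofReal_mul (by positivity), ← Real.exp_add]
  ring_nf

instance isProbabilityMeasure_expMeasure_one : IsProbabilityMeasure (expMeasure 1) :=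
  isProbabilityMeasure_expMeasure one_pos

lemma lintegral_prod_expClocks (n : ℕ) (u : ℕ → ℝ → ℝ≥0∞) (hu : ∀ k, Measurable (u k)) :
    ∫⁻ e : ℕ → ℝ, ∏ k ∈ Finset.range n, u k (e k) ∂Measure.infinitePi (fun _ => expMeasure 1)
      = ∏ k ∈ Finset.range n, ∫⁻ t, u k t ∂expMeasure 1 := by
  rw [lintegral_prod_eq_prod_lintegral_of_indepFun _ _
    (iIndepFun_infinitePi (P := fun _ : ℕ => expMeasure 1) hu) fun k => by fun_prop]
  refine Finset.prod_congr rfl fun k _ => ?_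
  exact (measurePreserving_eval_infinitePi (fun _ : ℕ => expMeasure 1) k).lintegral_comp (hu k)

/-- Paths carry arbitrary real clocks, so monotonicity of the jump times is available only almost
surely. -/
lemma ae_expClocks_nonneg :
    ∀ᵐ e : ℕ → ℝ ∂Measure.infinitePi (fun _ => expMeasure 1), ∀ k, 0 ≤ e k := by
  rw [ae_all_iff]
  intro k
  have h : ∀ᵐ t ∂expMeasure 1, 0 ≤ t := by
    rw [ae_iff]
    have : {t : ℝ | ¬ 0 ≤ t} = Iio 0 := by ext; simp
    rw [this, expMeasure_eq_withDensity, withDensity_apply _ measurableSet_Iio]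
    exact lintegral_exponentialPDF_of_nonpos le_rfl
  exact (measurePreserving_eval_infinitePi (fun _ : ℕ => expMeasure 1) k).quasiMeasurePreserving.ae h

end Exponential

/-! ### Laplace–Stieltjes transforms as integrals over paths. -/

section Transform

/-- The discount factor `e^{-lam τ}`, equal to `0` for `τ = ∞`. -/
noncomputable def discountFactor (lam : ℝ) (τ : ℝ≥0∞) : ℝ≥0∞ :=
  if τ < ∞ then ENNReal.ofReal (Real.exp (-(lam * τ.toReal))) else 0

lemma laplaceStieltjes_improperLaw {Ω : Type*} [MeasurableSpace Ω] (P : Measure Ω)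
    {τ : Ω → ℝ≥0∞} (hτ : Measurable τ) (lam : ℝ) :
    laplaceStieltjes (improperLaw P τ) lam = (∫⁻ ω, discountFactor lam (τ ω) ∂P).toReal := by
  rw [laplaceStieltjes, improperLaw, integral_eq_lintegral_of_nonneg_ae
    (Eventually.of_forall fun _ => (Real.exp_pos _).le) (by fun_prop),
    lintegral_map (by fun_prop) (by fun_prop),
    ← lintegral_indicator (measurableSet_lt hτ measurable_const)]
  simp only [indicator_apply, discountFactor, mem_ofPred_eq]

end Transform

namespace QMatrix

/-! ### The law of the continuous-time chain. -/

section Law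

variable {S : Type*} (Q : QMatrix S)

/-- The rate `-q(x,x)` at which the chain leaves `x`. -/
def rate (x : S) : ℝ := -Q.q x x

lemma rate_pos (x : S) : 0 < Q.rate x := neg_pos.mpr (Q.diag_neg x)

/-- The Laplace transform of the time spent in `x`. -/
noncomputable def sojournTransform (lam : ℝ) (x : S) : ℝ≥0∞ :=
  ENNReal.ofReal (Q.rate x / (Q.rate x + lam))

lemma jumpTime_monotone {ω : Path S} (hω : ∀ k, 0 ≤ ω.2 k) : Monotone fun n => Q.jumpTime n ω := by
  refine monotone_nat_of_le_succ fun n => ?_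
  simp only [jumpTime, Finset.sum_range_succ, le_add_iff_nonneg_right]
  exact div_nonneg (hω n) (Q.rate_pos _).le

variable [Countable S] [MeasurableSpace S] [DiscreteMeasurableSpace S]

instance (x : S) : IsProbabilityMeasure (Q.law x) := by
  unfold law; infer_instance

lemma ae_law_clocks_nonneg (x : S) : ∀ᵐ ω ∂Q.law x, ∀ k, 0 ≤ ω.2 k :=
  Measure.quasiMeasurePreserving_snd.ae ae_expClocks_nonneg

lemma lintegral_law (x : S) (f : Path S → ℝ≥0∞) (hf : Measurable f) :
    ∫⁻ ω, f ω ∂Q.law x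
      = ∫⁻ X, ∫⁻ e, f (X, e) ∂Measure.infinitePi (fun _ => expMeasure 1) ∂Q.jumpChainLaw x :=
  lintegral_prod _ hf.aemeasurable

omit [Countable S] in
lemma measurable_holdingTime (k : ℕ) : Measurable (Q.holdingTime k) := by
  have h : Measurable fun x => -Q.q x x := Measurable.of_discrete
  exact Measurable.div (by fun_prop) (h.comp (by fun_prop))

omit [Countable S] in
lemma measurable_jumpTime (n : ℕ) : Measurable (Q.jumpTime n) :=
  Finset.measurable_fun_sum _ fun k _ => Q.measurable_holdingTime k

end Law

/-! ### Transforms of hitting times as path sums. -/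

section Hitting

variable {S : Type*} [Countable S] [MeasurableSpace S] [DiscreteMeasurableSpace S] (Q : QMatrix S)

omit [Countable S] in
lemma measurableSet_isFirstHit (H : Set S) (y : S) (n : ℕ) :
    MeasurableSet {ω : Path S | IsFirstHit H y ω n} := by
  have h1 : ∀ (m : ℕ) (A : Set S), MeasurableSet {ω : Path S | ω.1 m ∈ A} := fun m A =>
    ((measurable_pi_apply m).comp measurable_fst) (MeasurableSet.of_discrete (s := A))
  have : {ω : Path S | IsFirstHit H y ω n} = {ω | 1 ≤ n} ∩ ({ω | ω.1 n ∈ ({y} : Set S)} ∩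
      ⋂ m, ⋂ (_ : 1 ≤ m), ⋂ (_ : m < n), ({ω | ω.1 m ∈ ({y} : Set S)ᶜ} ∩ {ω | ω.1 m ∈ Hᶜ})) := by
    ext ω
    simp [IsFirstHit]
  rw [this]
  refine (MeasurableSet.const _).inter ((h1 _ _).inter ?_)
  exact MeasurableSet.iInter fun m => MeasurableSet.iInter fun _ => MeasurableSet.iInter fun _ =>
    (h1 _ _).inter (h1 _ _)

omit [Countable S] [MeasurableSpace S] [DiscreteMeasurableSpace S] in
lemma IsFirstHit.unique {H : Set S} {y : S} {ω : Path S} {m n : ℕ} (hm : IsFirstHit H y ω m)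
    (hn : IsFirstHit H y ω n) : m = n := by
  rcases lt_trichotomy m n with h | h | h
  · exact absurd hm.2.1 (hn.2.2 m hm.1 h).1
  · exact h
  · exact absurd hn.2.1 (hm.2.2 n hn.1 h).1

omit [Countable S] [MeasurableSpace S] [DiscreteMeasurableSpace S] in
lemma iInf_isFirstHit_eq {H : Set S} {y : S} {ω : Path S} {n : ℕ} (hn : IsFirstHit H y ω n)
    (g : ℕ → ℝ) : ⨅ (n : ℕ) (_ : IsFirstHit H y ω n), ENNReal.ofReal (g n)
      = ENNReal.ofReal (g n) := by
  refine le_antisymm (iInf₂_le n hn) (le_iInf₂ fun m hm => ?_)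
  rw [hm.unique hn]

omit [Countable S] in
lemma measurable_iInf_isFirstHit (H : Set S) (y : S) (g : ℕ → Path S → ℝ)
    (hg : ∀ n, Measurable (g n)) :
    Measurable fun ω : Path S => ⨅ (n : ℕ) (_ : IsFirstHit H y ω n), ENNReal.ofReal (g n ω) := by
  classical
  refine Measurable.iInf fun n => ?_
  have : (fun ω : Path S => ⨅ (_ : IsFirstHit H y ω n), ENNReal.ofReal (g n ω))
      = fun ω => if IsFirstHit H y ω n then ENNReal.ofReal (g n ω) else ⊤ := by
    funext ω
    exact iInf_eq_if _
  rw [this]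
  exact Measurable.ite (measurableSet_isFirstHit H y n) (hg n).ennreal_ofReal measurable_const

omit [Countable S] in
lemma measurable_exitHittingTime (H : Set S) (y : S) : Measurable (Q.exitHittingTime H y) :=
  measurable_iInf_isFirstHit H y _ fun n => (Q.measurable_jumpTime n).sub (Q.measurable_jumpTime 1)

omit [Countable S] in
lemma measurable_hittingTime (H : Set S) (y : S) : Measurable (Q.hittingTime H y) :=
  measurable_iInf_isFirstHit H y _ fun n => Q.measurable_jumpTime n

-- The product of indicators is `1` exactly when `n + 1` is the first hit, which happens for at most
-- one `n`. The shift reflects that a hit needs at least one jump, and `y` joins `H` because it too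
-- is avoided before the hit.
omit [Countable S] [MeasurableSpace S] [DiscreteMeasurableSpace S] in
lemma discountFactor_iInf_isFirstHit (H : Set S) (y : S) (lam : ℝ) (ω : Path S)
    (g : ℕ → ℝ) (hg : ∀ n, 0 ≤ g (n + 1)) :
    discountFactor lam (⨅ (n : ℕ) (_ : IsFirstHit H y ω n), ENNReal.ofReal (g n))
      = ∑' n, (∏ m ∈ Finset.range n, (insert y H)ᶜ.indicator 1 (ω.1 (m + 1)))
        * ({y} : Set S).indicator 1 (ω.1 (n + 1))
        * ENNReal.ofReal (Real.exp (-(lam * g (n + 1)))) := by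
  have hmul : ∀ n, (∏ m ∈ Finset.range n, (insert y H)ᶜ.indicator (1 : S → ℝ≥0∞) (ω.1 (m + 1)))
        * ({y} : Set S).indicator 1 (ω.1 (n + 1)) ≠ 0 ↔ IsFirstHit H y ω (n + 1) := by
    intro n
    rw [mul_ne_zero_iff, Finset.prod_ne_zero_iff]
    simp only [Finset.mem_range, indicator_apply_ne_zero, IsFirstHit, mem_inter_iff, mem_compl_iff,
      mem_insert_iff, not_or, Function.support_one, mem_univ, and_true, mem_singleton_iff]
    constructor
    · rintro ⟨h1, h2⟩
      refine ⟨by omega, h2, fun m hm1 hm2 => ?_⟩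
      obtain ⟨k, rfl⟩ : ∃ k, m = k + 1 := ⟨m - 1, by omega⟩
      exact h1 k (by omega)
    · rintro ⟨-, h2, h3⟩
      exact ⟨fun m hm => h3 (m + 1) (by omega) (by omega), h2⟩
  have hone : ∀ n, IsFirstHit H y ω (n + 1) →
      (∏ m ∈ Finset.range n, (insert y H)ᶜ.indicator (1 : S → ℝ≥0∞) (ω.1 (m + 1)))
        * ({y} : Set S).indicator 1 (ω.1 (n + 1)) = 1 := by
    intro n hn
    rw [Finset.prod_eq_one, one_mul, indicator_of_mem (by simpa using hn.2.1), Pi.one_apply]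
    intro m hm
    have h := hn.2.2 (m + 1) (by omega) (by simpa using hm)
    rw [indicator_of_mem (by simpa using h), Pi.one_apply]
  by_cases hex : ∃ n, IsFirstHit H y ω n
  · obtain ⟨n, hn⟩ := hex
    obtain ⟨k, rfl⟩ : ∃ k, n = k + 1 := ⟨n - 1, by have := hn.1; omega⟩
    rw [iInf_isFirstHit_eq hn, tsum_eq_single k, hone k hn, discountFactor,
      if_pos ENNReal.ofReal_lt_top, ENNReal.toReal_ofReal (hg k), one_mul]
    intro l hl
    have : ¬ IsFirstHit H y ω (l + 1) := fun h => hl (by have := h.unique hn; omega)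
    rw [← hmul, not_not] at this
    rw [this, zero_mul]
  · push Not at hex
    have h1 : ⨅ (n : ℕ) (_ : IsFirstHit H y ω n), ENNReal.ofReal (g n) = ⊤ := by
      simp [hex]
    rw [h1, discountFactor, if_neg (lt_irrefl _), eq_comm, ENNReal.tsum_eq_zero]
    intro n
    have := hex (n + 1)
    rw [← hmul, not_not] at this
    rw [this, zero_mul]

/-- The transform of a first hitting time, when the first holding time is counted with the
factor `c`. -/
lemma lintegral_discountFactor_iInf (H : Set S) (x y : S) {lam c : ℝ} (hlam : 0 ≤ lam)
    (hc : 0 ≤ c) (g : ℕ → Path S → ℝ)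
    (hg : ∀ n ω, g (n + 1) ω
      = c * Q.holdingTime 0 ω + ∑ m ∈ Finset.range n, Q.holdingTime (m + 1) ω) :
    ∫⁻ ω, discountFactor lam (⨅ (n : ℕ) (_ : IsFirstHit H y ω n), ENNReal.ofReal (g n ω)) ∂Q.law x
      = Q.sojournTransform (c * lam) x
        * Q.innerPathSum ((insert y H)ᶜ.indicator (Q.sojournTransform lam)) x y := by
  have hgm : ∀ n, Measurable (g (n + 1)) := by
    intro n
    rw [funext (hg n)]
    exact ((Q.measurable_holdingTime 0).const_mul c).add
      (Finset.measurable_fun_sum _ fun k _ => Q.measurable_holdingTime (k + 1))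
  have hX : ∀ (f : S → ℝ≥0∞) (m : ℕ), Measurable fun ω : Path S => f (ω.1 m) := fun f m =>
    (Measurable.of_discrete (f := f)).comp (by fun_prop)
  have hae : ∀ᵐ ω ∂Q.law x,
      discountFactor lam (⨅ (n : ℕ) (_ : IsFirstHit H y ω n), ENNReal.ofReal (g n ω))
      = ∑' n, (∏ m ∈ Finset.range n, (insert y H)ᶜ.indicator 1 (ω.1 (m + 1)))
        * ({y} : Set S).indicator 1 (ω.1 (n + 1))
        * ENNReal.ofReal (Real.exp (-(lam * g (n + 1) ω))) := by
    filter_upwards [Q.ae_law_clocks_nonneg x] with ω hω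
    have hh : ∀ k, 0 ≤ Q.holdingTime k ω := fun k => div_nonneg (hω k) (Q.rate_pos _).le
    refine discountFactor_iInf_isFirstHit H y lam ω (fun n => g n ω) fun n => ?_
    rw [hg]
    exact add_nonneg (mul_nonneg hc (hh 0)) (Finset.sum_nonneg fun k _ => hh _)
  have hmeas : ∀ n, Measurable fun ω : Path S =>
      (∏ m ∈ Finset.range n, (insert y H)ᶜ.indicator (1 : S → ℝ≥0∞) (ω.1 (m + 1)))
        * ({y} : Set S).indicator 1 (ω.1 (n + 1))
        * ENNReal.ofReal (Real.exp (-(lam * g (n + 1) ω))) := by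
    intro n
    refine Measurable.mul (Measurable.mul (Finset.measurable_fun_prod _ fun m _ => hX _ _) (hX _ _)) ?_
    have := hgm n
    fun_prop
  rw [lintegral_congr_ae hae, lintegral_tsum fun n => (hmeas n).aemeasurable, innerPathSum,
    ← ENNReal.tsum_mul_left]
  refine tsum_congr fun n => ?_
  rw [← lintegral_jumpChainLaw_prod, Q.lintegral_law x _ (hmeas n)]
  refine lintegral_congr fun X => ?_
  simp only
  rw [lintegral_const_mul]
  -- With the visited states fixed, the discount splits into one factor per clock. The clock of the
  -- starting state is discounted at `c * lam`: `c = 0` counts from the exit, `c = 1` from time `0`.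
  · let l : ℕ → ℝ := fun k => if k = 0 then c * lam else lam
    have hl : ∀ k, 0 ≤ l k := fun k => by
      simp only [l]; split_ifs <;> positivity
    have h1 : ∀ e : ℕ → ℝ, ENNReal.ofReal (Real.exp (-(lam * g (n + 1) (X, e))))
        = ∏ k ∈ Finset.range (n + 1), ENNReal.ofReal (Real.exp (-(l k * (e k / Q.rate (X k))))) := by
      intro e
      rw [← ENNReal.ofReal_prod_of_nonneg fun _ _ => (Real.exp_pos _).le, ← Real.exp_sum, hg,
        Finset.sum_neg_distrib, Finset.sum_range_succ']
      congr 3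
      simp only [l, holdingTime, rate, if_true, Nat.succ_ne_zero, if_false, mul_add, Finset.mul_sum]
      ring
    simp only [h1]
    rw [lintegral_prod_expClocks (n + 1)
      (fun k t => ENNReal.ofReal (Real.exp (-(l k * (t / Q.rate (X k)))))) fun k => by fun_prop]
    simp only [lintegral_exp_div_expMeasure_one (Q.rate_pos _) (hl _)]
    rw [Finset.prod_range_succ']
    simp only [l, Nat.succ_ne_zero, if_false, if_true]
    have h2 : ∀ m, (insert y H)ᶜ.indicator (Q.sojournTransform lam) (X (m + 1))
        = (insert y H)ᶜ.indicator 1 (X (m + 1))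
          * ENNReal.ofReal (Q.rate (X (m + 1)) / (Q.rate (X (m + 1)) + lam)) := by
      intro m
      by_cases hm : X (m + 1) ∈ (insert y H)ᶜ <;> simp [hm, sojournTransform]
    simp only [h2, Finset.prod_mul_distrib, sojournTransform]
    ring
  · have := (hgm n).comp (measurable_prodMk_left (x := X))
    exact (Real.measurable_exp.comp (this.const_mul lam).neg).ennreal_ofReal

lemma lintegral_discountFactor_exitHittingTime (H : Set S) (x y : S) {lam : ℝ} (hlam : 0 ≤ lam) :
    ∫⁻ ω, discountFactor lam (Q.exitHittingTime H y ω) ∂Q.law x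
      = Q.innerPathSum ((insert y H)ᶜ.indicator (Q.sojournTransform lam)) x y := by
  have h := Q.lintegral_discountFactor_iInf H x y hlam le_rfl
    (fun n ω => Q.jumpTime n ω - Q.jumpTime 1 ω) (fun n ω => by
      simp [jumpTime, Finset.sum_range_succ'])
  rw [zero_mul, sojournTransform, add_zero, div_self (Q.rate_pos x).ne', ENNReal.ofReal_one,
    one_mul] at h
  exact h

lemma lintegral_discountFactor_hittingTime (H : Set S) (x y : S) {lam : ℝ} (hlam : 0 ≤ lam) :
    ∫⁻ ω, discountFactor lam (Q.hittingTime H y ω) ∂Q.law x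
      = Q.sojournTransform lam x
        * Q.innerPathSum ((insert y H)ᶜ.indicator (Q.sojournTransform lam)) x y := by
  have h := Q.lintegral_discountFactor_iInf H x y hlam zero_le_one
    (fun n ω => Q.jumpTime n ω) (fun n ω => by
      simp [jumpTime, Finset.sum_range_succ', add_comm])
  rw [one_mul] at h
  exact h

end Hitting

/-! ### The Green function as a path sum. -/

section Green

variable {S : Type*} [Countable S] [MeasurableSpace S] [DiscreteMeasurableSpace S] (Q : QMatrix S)

-- For nonnegative clocks the sojourn intervals are pairwise disjoint, so at most one term is
-- nonzero. A time after explosion lies in none of them and both sides vanish.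
omit [Countable S] [MeasurableSpace S] [DiscreteMeasurableSpace S] in
lemma indicator_stateEvent (t : ℝ) (y : S) {ω : Path S} (hω : ∀ k, 0 ≤ ω.2 k) :
    (Q.stateEvent t y).indicator (1 : Path S → ℝ≥0∞) ω
      = ∑' n, ({y} : Set S).indicator 1 (ω.1 n)
        * (Ico (Q.jumpTime n ω) (Q.jumpTime (n + 1) ω)).indicator 1 t := by
  by_cases h : ω ∈ Q.stateEvent t y
  · rw [indicator_of_mem h]
    obtain ⟨n, h1, h2, h3⟩ := h
    rw [tsum_eq_single n]
    · rw [indicator_of_mem (by simpa using h3), indicator_of_mem (mem_Ico.mpr ⟨h1, h2⟩)]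
      simp
    · intro m hm
      have hd := (Q.jumpTime_monotone hω).pairwise_disjoint_on_Ico_succ hm
      have : t ∉ Ico (Q.jumpTime m ω) (Q.jumpTime (m + 1) ω) := fun hm' =>
        Set.disjoint_left.mp hd hm' ⟨h1, h2⟩
      rw [indicator_of_notMem this, mul_zero]
  · rw [indicator_of_notMem h, eq_comm, ENNReal.tsum_eq_zero]
    intro n
    by_contra hne
    rw [← ne_eq, mul_ne_zero_iff] at hne
    simp only [indicator_apply_ne_zero, mem_inter_iff, Function.support_one, mem_univ, and_true,
      mem_singleton_iff] at hne
    exact h ⟨n, hne.2.1, hne.2.2, hne.1⟩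

omit [Countable S] in
lemma measurableSet_stateEvent_prod (y : S) :
    MeasurableSet {p : ℝ × Path S | p.2 ∈ Q.stateEvent p.1 y} := by
  have : {p : ℝ × Path S | p.2 ∈ Q.stateEvent p.1 y}
      = ⋃ n, ({p : ℝ × Path S | Q.jumpTime n p.2 ≤ p.1} ∩ ({p | p.1 < Q.jumpTime (n + 1) p.2} ∩
        {p | p.2.1 n ∈ ({y} : Set S)})) := by
    ext p
    simp [stateEvent]
  rw [this]
  have hJ := Q.measurable_jumpTime
  refine MeasurableSet.iUnion fun n => ?_
  refine (measurableSet_le ((hJ n).comp measurable_snd) measurable_fst).inter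
    ((measurableSet_lt measurable_fst ((hJ (n + 1)).comp measurable_snd)).inter ?_)
  exact ((measurable_pi_apply n).comp (measurable_fst.comp measurable_snd))
    (MeasurableSet.of_discrete (s := ({y} : Set S)))

lemma measurable_law_stateEvent (x y : S) : Measurable fun t => Q.law x (Q.stateEvent t y) :=
  measurable_measure_prodMk_left (Q.measurableSet_stateEvent_prod y)

/-- The chain integral of the product of weights along a path ending in `y`. -/
lemma lintegral_jumpChainLaw_prod_indicator (a : S → ℝ≥0∞) (x y : S) (n : ℕ) :
    ∫⁻ X, (∏ k ∈ Finset.range n, a (X k)) * ({y} : Set S).indicator 1 (X n) ∂Q.jumpChainLaw x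
      = (Q.weightedStep a)^[n] (({y} : Set S).indicator 1) x := by
  cases n with
  | zero => simpa using Q.lintegral_jumpChainLaw_zero x (({y} : Set S).indicator 1)
  | succ n =>
    rw [Function.iterate_succ_apply', weightedStep, ← lintegral_jumpChainLaw_prod]
    refine lintegral_congr fun X => ?_
    rw [Finset.prod_range_succ', mul_comm (a (X 0))]

lemma lintegral_discounted_Ico {J h lam : ℝ} (hJ : 0 ≤ J) :
    ∫⁻ t in Ioi 0, ENNReal.ofReal (Real.exp (-(lam * t))) * (Ico J (J + h)).indicator 1 t
      = ENNReal.ofReal (Real.exp (-(lam * J)))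
        * ∫⁻ s in Ici 0, ENNReal.ofReal (Real.exp (-(lam * s))) * (Iio h).indicator 1 s := by
  rw [setLIntegral_congr Ioi_ae_eq_Ici, ← lintegral_indicator measurableSet_Ici,
    ← lintegral_indicator measurableSet_Ici, ← lintegral_add_right_eq_self _ J,
    ← lintegral_const_mul]
  · refine lintegral_congr fun s => ?_
    simp only [indicator_apply, mem_Ici, mem_Ico, mem_Iio, Pi.one_apply,
      add_comm s J, add_lt_add_iff_left, le_add_iff_nonneg_right]
    by_cases hs : 0 ≤ s
    · rw [if_pos (by positivity), if_pos hs, ← mul_assoc, ← ENNReal.ofReal_mul (by positivity),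
        ← Real.exp_add, mul_add, neg_add]
      simp [hs]
    · simp [hs]
  · refine Measurable.indicator (Measurable.mul (by fun_prop) ?_) measurableSet_Ici
    exact measurable_one.indicator measurableSet_Iio

/-- The Laplace transform of the transition probability as a sum over paths. -/
lemma lintegral_exp_mul_law_stateEvent (x y : S) {lam : ℝ} (hlam : 0 ≤ lam) :
    ∫⁻ t in Ioi 0, ENNReal.ofReal (Real.exp (-(lam * t))) * Q.law x (Q.stateEvent t y)
      = Q.pathSum (Q.sojournTransform lam) x y * ENNReal.ofReal (1 / (Q.rate y + lam)) := by
  have hJ := Q.measurable_jumpTime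
  have hX : ∀ n : ℕ, Measurable fun ω : Path S => ({y} : Set S).indicator (1 : S → ℝ≥0∞) (ω.1 n) :=
    fun n => (Measurable.of_discrete (f := ({y} : Set S).indicator (1 : S → ℝ≥0∞))).comp
      (by fun_prop)
  have hI : ∀ n, Measurable fun p : ℝ × Path S =>
      (Ico (Q.jumpTime n p.2) (Q.jumpTime (n + 1) p.2)).indicator (1 : ℝ → ℝ≥0∞) p.1 := by
    intro n
    have : (fun p : ℝ × Path S =>
        (Ico (Q.jumpTime n p.2) (Q.jumpTime (n + 1) p.2)).indicator (1 : ℝ → ℝ≥0∞) p.1)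
        = ({p : ℝ × Path S | Q.jumpTime n p.2 ≤ p.1} ∩
          {p | p.1 < Q.jumpTime (n + 1) p.2}).indicator 1 := by
      funext p; simp [indicator_apply]
    rw [this]
    exact measurable_one.indicator
      ((measurableSet_le ((hJ n).comp measurable_snd) measurable_fst).inter
        (measurableSet_lt measurable_fst ((hJ (n + 1)).comp measurable_snd)))
  have hF : ∀ n, Measurable fun p : ℝ × Path S => ENNReal.ofReal (Real.exp (-(lam * p.1)))
      * (({y} : Set S).indicator 1 (p.2.1 n)
        * (Ico (Q.jumpTime n p.2) (Q.jumpTime (n + 1) p.2)).indicator (1 : ℝ → ℝ≥0∞) p.1) :=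
    fun n => Measurable.mul (by fun_prop) (Measurable.mul ((hX n).comp measurable_snd) (hI n))
  have hG : ∀ (t : ℝ) (n : ℕ), Measurable fun ω : Path S => ({y} : Set S).indicator 1 (ω.1 n)
      * (Ico (Q.jumpTime n ω) (Q.jumpTime (n + 1) ω)).indicator (1 : ℝ → ℝ≥0∞) t :=
    fun t n => Measurable.mul (hX n) ((hI n).comp measurable_prodMk_left)
  have h1 : ∀ t, ENNReal.ofReal (Real.exp (-(lam * t))) * Q.law x (Q.stateEvent t y)
      = ∑' n, ∫⁻ ω, ENNReal.ofReal (Real.exp (-(lam * t))) * (({y} : Set S).indicator 1 (ω.1 n)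
        * (Ico (Q.jumpTime n ω) (Q.jumpTime (n + 1) ω)).indicator 1 t) ∂Q.law x := by
    intro t
    have hm : MeasurableSet (Q.stateEvent t y) :=
      measurable_prodMk_left (x := t) (Q.measurableSet_stateEvent_prod y)
    rw [← lintegral_indicator_one hm, lintegral_congr_ae ((Q.ae_law_clocks_nonneg x).mono
        fun ω hω => Q.indicator_stateEvent t y hω),
      lintegral_tsum fun n => (hG t n).aemeasurable,
      ← ENNReal.tsum_mul_left]
    refine tsum_congr fun n => ?_
    rw [lintegral_const_mul _ (hG t n)]
  simp only [h1]
  rw [lintegral_tsum fun n => (hF n).lintegral_prod_right'.aemeasurable, pathSum,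
    ← ENNReal.tsum_mul_right]
  refine tsum_congr fun n => ?_
  rw [lintegral_lintegral_swap (hF n).aemeasurable]
  let ψ : S → ℝ → ℝ≥0∞ := fun z e => ∫⁻ s in Ici 0,
    ENNReal.ofReal (Real.exp (-(lam * s))) * (Iio (e / Q.rate z)).indicator 1 s
  -- Clocks of completed sojourns contribute a discount up to the `n`-th jump; the `n`-th clock
  -- contributes the discounted length of the current sojourn.
  let u : (ℕ → S) → ℕ → ℝ → ℝ≥0∞ := fun X k e =>
    if k < n then ENNReal.ofReal (Real.exp (-(lam * (e / Q.rate (X k))))) else ψ (X k) e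
  have hae : ∀ᵐ ω ∂Q.law x, ∫⁻ t in Ioi 0, ENNReal.ofReal (Real.exp (-(lam * t)))
      * (({y} : Set S).indicator 1 (ω.1 n)
        * (Ico (Q.jumpTime n ω) (Q.jumpTime (n + 1) ω)).indicator 1 t)
      = ({y} : Set S).indicator 1 (ω.1 n) * ∏ k ∈ Finset.range (n + 1), u ω.1 k (ω.2 k) := by
    filter_upwards [Q.ae_law_clocks_nonneg x] with ω hω
    have hJ0 : 0 ≤ Q.jumpTime n ω := by
      simpa [jumpTime] using Q.jumpTime_monotone hω (Nat.zero_le n)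
    simp only [mul_left_comm (ENNReal.ofReal _)]
    have hm : Measurable fun t => ENNReal.ofReal (Real.exp (-(lam * t)))
        * (Ico (Q.jumpTime n ω) (Q.jumpTime (n + 1) ω)).indicator (1 : ℝ → ℝ≥0∞) t :=
      Measurable.mul (by fun_prop) (measurable_one.indicator measurableSet_Ico)
    rw [lintegral_const_mul _ hm]
    congr 1
    have hsucc : Q.jumpTime (n + 1) ω = Q.jumpTime n ω + ω.2 n / Q.rate (ω.1 n) := by
      simp only [jumpTime, Finset.sum_range_succ, holdingTime, rate]
    rw [hsucc, lintegral_discounted_Ico hJ0, Finset.prod_range_succ]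
    congr 1
    · rw [jumpTime, Finset.mul_sum, ← Finset.sum_neg_distrib, Real.exp_sum,
        ENNReal.ofReal_prod_of_nonneg fun _ _ => (Real.exp_pos _).le]
      refine Finset.prod_congr rfl fun k hk => ?_
      simp only [u, if_pos (Finset.mem_range.mp hk)]
      rfl
    · simp [u, ψ]
  have hψ : ∀ z, Measurable (ψ z) := by
    intro z
    refine Measurable.lintegral_prod_right' (f := fun p : ℝ × ℝ =>
      ENNReal.ofReal (Real.exp (-(lam * p.2))) * (Iio (p.1 / Q.rate z)).indicator 1 p.2) ?_
    refine Measurable.mul (by fun_prop) ?_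
    have : (fun p : ℝ × ℝ => (Iio (p.1 / Q.rate z)).indicator (1 : ℝ → ℝ≥0∞) p.2)
        = {p : ℝ × ℝ | p.2 < p.1 / Q.rate z}.indicator 1 := by
      funext p; simp [indicator_apply]
    rw [this]
    exact measurable_one.indicator (measurableSet_lt (by fun_prop) (by fun_prop))
  have hu : ∀ X k, Measurable (u X k) := by
    intro X k
    simp only [u]
    split_ifs
    · fun_prop
    · exact hψ _
  have hu' : ∀ k, Measurable fun ω : Path S => u ω.1 k (ω.2 k) := by
    intro k
    have h2 : Measurable (Function.uncurry fun (e : ℝ) (z : S) =>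
        if k < n then ENNReal.ofReal (Real.exp (-(lam * (e / Q.rate z)))) else ψ z e) := by
      refine measurable_from_prod_countable_left fun z => ?_
      simp only [Function.uncurry]
      split_ifs
      · fun_prop
      · exact hψ _
    exact h2.comp (f := fun ω : Path S => (ω.2 k, ω.1 k)) (by fun_prop)
  have hprod : Measurable fun ω : Path S => ({y} : Set S).indicator (1 : S → ℝ≥0∞) (ω.1 n)
      * ∏ k ∈ Finset.range (n + 1), u ω.1 k (ω.2 k) :=
    Measurable.mul (hX n) (Finset.measurable_fun_prod _ fun k _ => hu' k)
  rw [lintegral_congr_ae hae, Q.lintegral_law x _ hprod,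
    ← lintegral_jumpChainLaw_prod_indicator, ← lintegral_mul_const]
  · refine lintegral_congr fun X => ?_
    simp only
    have hm : Measurable fun e : ℕ → ℝ => ∏ k ∈ Finset.range (n + 1), u X k (e k) :=
      Finset.measurable_fun_prod _ fun k _ => (hu X k).comp (measurable_pi_apply k)
    rw [lintegral_const_mul _ hm, lintegral_prod_expClocks _ _ (hu X),
      Finset.prod_range_succ]
    have h3 : ∫⁻ t, u X n t ∂expMeasure 1 = ENNReal.ofReal (1 / (Q.rate (X n) + lam)) := by
      simp only [u, lt_irrefl, if_false]
      exact lintegral_discounted_sojourn (Q.rate_pos _) hlam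
    have h4 : ∏ k ∈ Finset.range n, ∫⁻ t, u X k t ∂expMeasure 1
        = ∏ k ∈ Finset.range n, Q.sojournTransform lam (X k) := by
      refine Finset.prod_congr rfl fun k hk => ?_
      simp only [u, if_pos (Finset.mem_range.mp hk)]
      exact lintegral_exp_div_expMeasure_one (Q.rate_pos _) hlam
    rw [h3, h4]
    by_cases hy : X n = y
    · rw [hy]; ring
    · simp [hy]
  · exact Measurable.mul (Finset.measurable_fun_prod _ fun k _ =>
      (Measurable.of_discrete (f := Q.sojournTransform lam)).comp (measurable_pi_apply k))
      ((Measurable.of_discrete (f := ({y} : Set S).indicator (1 : S → ℝ≥0∞))).comp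
        (measurable_pi_apply n))

end Green

end QMatrix

/-! ### Renewal equations and finiteness of the Green function. -/

namespace QMatrix

variable {S : Type*} [Countable S] [MeasurableSpace S] [DiscreteMeasurableSpace S] (Q : QMatrix S)

/-- The Green function with values in `[0, ∞]`, for all `lam ≥ 0`. -/
noncomputable def extGreen (lam : ℝ) (x y : S) : ℝ≥0∞ :=
  ∫⁻ t in Ioi 0, ENNReal.ofReal (Real.exp (-(lam * t))) * Q.law x (Q.stateEvent t y)

lemma integral_exp_mul_transProb (lam : ℝ) (x y : S) :
    ∫ t in Ioi (0 : ℝ), Real.exp (-(lam * t)) * Q.transProb t x y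
      = (Q.extGreen lam x y).toReal := by
  have hm := Q.measurable_law_stateEvent x y
  rw [integral_eq_lintegral_of_nonneg_ae]
  · congr 1
    refine lintegral_congr fun t => ?_
    rw [ENNReal.ofReal_mul (Real.exp_pos _).le, transProb, ofReal_measureReal]
  · exact Eventually.of_forall fun t => mul_nonneg (Real.exp_pos _).le measureReal_nonneg
  · exact (Measurable.mul (by fun_prop) hm.ennreal_toReal).aestronglyMeasurable

lemma green_of_pos {lam : ℝ} (hlam : 0 < lam) (x y : S) :
    Q.green lam x y = (Q.extGreen lam x y).toReal := by
  rw [green, if_pos hlam, integral_exp_mul_transProb]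

lemma extGreen_lt_top {lam : ℝ} (hlam : 0 < lam) (x y : S) : Q.extGreen lam x y < ∞ := by
  refine lt_of_le_of_lt (b := ∫⁻ t in Ici 0, ENNReal.ofReal (Real.exp (-(lam * t)))) ?_ ?_
  · refine (lintegral_mono' (Measure.restrict_mono Ioi_subset_Ici_self le_rfl) fun t => ?_)
    exact mul_le_of_le_one_right' prob_le_one
  · rw [lintegral_Ici_exp_neg hlam]
    exact ENNReal.ofReal_lt_top

/-- First-entrance decomposition of the Green function. -/
lemma extGreen_eq_add_sum {ι : Type*} [Fintype ι] {lam : ℝ} (hlam : 0 ≤ lam) (w : ι → S)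
    (hw : Function.Injective w) (x : S) (j : ι) :
    Q.extGreen lam x (w j)
      = ({w j} : Set S).indicator 1 x * ENNReal.ofReal (1 / (Q.rate (w j) + lam))
        + Q.sojournTransform lam x
          * ∑ k, Q.innerPathSum ((range w)ᶜ.indicator (Q.sojournTransform lam)) x (w k)
            * Q.extGreen lam (w k) (w j) := by
  simp only [extGreen, Q.lintegral_exp_mul_law_stateEvent _ _ hlam]
  rw [Q.pathSum_eq_indicator_add_sum _ w hw x j, add_mul, mul_assoc, Finset.sum_mul]
  simp only [mul_assoc]

/-- The transform of the hitting time of `y`, counted from time `0`, with values in `[0, ∞]`. -/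
noncomputable def hittingTransform (lam : ℝ) (x y : S) : ℝ≥0∞ :=
  ∫⁻ ω, discountFactor lam (Q.hittingTime ∅ y ω) ∂Q.law x

/-- The first-entrance decomposition for the one-point family `{y}`. -/
lemma extGreen_eq_add_hittingTransform {lam : ℝ} (hlam : 0 ≤ lam) (x y : S) :
    Q.extGreen lam x y
      = ({y} : Set S).indicator 1 x * ENNReal.ofReal (1 / (Q.rate y + lam))
        + Q.hittingTransform lam x y * Q.extGreen lam y y := by
  have h := Q.extGreen_eq_add_sum hlam (fun _ : Unit => y) (fun _ _ _ => rfl) x ()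
  rw [hittingTransform, Q.lintegral_discountFactor_hittingTime ∅ x y hlam]
  simpa [range_const, mul_assoc] using h

omit [Countable S] [MeasurableSpace S] [DiscreteMeasurableSpace S] in
lemma discountFactor_anti {lam mu : ℝ} (h : lam ≤ mu) (τ : ℝ≥0∞) :
    discountFactor mu τ ≤ discountFactor lam τ := by
  unfold discountFactor
  split_ifs
  · gcongr
  · exact le_rfl

omit [Countable S] [MeasurableSpace S] [DiscreteMeasurableSpace S] in
lemma discountFactor_le_one {lam : ℝ} (h : 0 ≤ lam) (τ : ℝ≥0∞) : discountFactor lam τ ≤ 1 := by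
  unfold discountFactor
  split_ifs
  · rw [ENNReal.ofReal_le_one, Real.exp_le_one_iff, neg_nonpos]
    positivity
  · exact zero_le_one

lemma lintegral_discountFactor_le_one {lam : ℝ} (h : 0 ≤ lam) (x : S) (τ : Path S → ℝ≥0∞) :
    ∫⁻ ω, discountFactor lam (τ ω) ∂Q.law x ≤ 1 := by
  calc ∫⁻ ω, discountFactor lam (τ ω) ∂Q.law x ≤ ∫⁻ _, 1 ∂Q.law x :=
        lintegral_mono fun ω => discountFactor_le_one h _
    _ = 1 := by simp

lemma hittingTransform_zero (x y : S) :
    Q.hittingTransform 0 x y = Q.law x {ω | Q.hittingTime ∅ y ω < ∞} := by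
  have hm := measurableSet_lt (Q.measurable_hittingTime ∅ y) (measurable_const (a := ∞))
  rw [hittingTransform, ← lintegral_indicator_one hm]
  refine lintegral_congr fun ω => ?_
  simp [discountFactor, indicator_apply]

/-- The renewal equation bounds `G` by `1/q + F(0) G`, since `F(r) ≤ F(0)`; finiteness of `G` for `r
> 0` allows solving for it. The bound does not depend on `r`. -/
lemma extGreen_diag_le_of_pos {r : ℝ} (hr : 0 < r) (y : S) :
    Q.extGreen r y y ≤ ENNReal.ofReal (1 / Q.rate y) / (1 - Q.hittingTransform 0 y y) := by
  have hfin := (Q.extGreen_lt_top hr y y).ne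
  have hF : Q.hittingTransform r y y ≤ Q.hittingTransform 0 y y :=
    lintegral_mono fun ω => discountFactor_anti hr.le _
  have hle : Q.extGreen r y y
      ≤ ENNReal.ofReal (1 / Q.rate y) + Q.hittingTransform 0 y y * Q.extGreen r y y := by
    conv_lhs => rw [Q.extGreen_eq_add_hittingTransform hr.le y y]
    have hq := Q.rate_pos y
    simp only [mem_singleton_iff, indicator_of_mem, Pi.one_apply, one_mul]
    gcongr
    linarith
  rw [ENNReal.le_div_iff_mul_le]
  · rw [ENNReal.mul_sub fun _ _ => hfin, mul_one, tsub_le_iff_right, mul_comm (Q.extGreen r y y)]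
    exact hle
  · exact Or.inr (by simpa using Q.rate_pos y)
  · exact Or.inr ENNReal.ofReal_ne_top

/-- At `0` the renewal equation cannot be solved directly, as `G` might be infinite; monotone
convergence along `1/(n+1)` carries the uniform bound over. -/
lemma extGreen_diag_zero_le (y : S) :
    Q.extGreen 0 y y ≤ ENNReal.ofReal (1 / Q.rate y) / (1 - Q.hittingTransform 0 y y) := by
  have hm := Q.measurable_law_stateEvent y y
  have hlim : Tendsto (fun n : ℕ => Q.extGreen (1 / ((n : ℝ) + 1)) y y) atTop
      (𝓝 (Q.extGreen 0 y y)) := by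
    refine lintegral_tendsto_of_tendsto_of_monotone
      (fun n => (Measurable.mul (by fun_prop) hm).aemeasurable) ?_ ?_
    · refine (ae_restrict_iff' measurableSet_Ioi).mpr (Eventually.of_forall fun t ht => ?_)
      intro m n hmn
      have h1 := Nat.one_div_le_one_div (α := ℝ) hmn
      have ht' : (0 : ℝ) ≤ t := le_of_lt ht
      dsimp only
      gcongr
    · refine Eventually.of_forall fun t => ?_
      refine ENNReal.Tendsto.mul_const ?_ (Or.inr (measure_ne_top _ _))
      refine ENNReal.tendsto_ofReal ((Real.continuous_exp.tendsto _).comp ?_)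
      exact (tendsto_one_div_add_atTop_nhds_zero_nat.mul_const t).neg
  exact le_of_tendsto' hlim fun n => Q.extGreen_diag_le_of_pos (by positivity) y

section Transient

variable {Q}

lemma Transient.extGreen_zero_lt_top (hQ : Q.Transient) (x y : S) : Q.extGreen 0 x y < ∞ := by
  have hyy : Q.extGreen 0 y y < ∞ := by
    refine (Q.extGreen_diag_zero_le y).trans_lt (ENNReal.div_lt_top ENNReal.ofReal_ne_top ?_)
    rw [hittingTransform_zero]
    exact (tsub_pos_of_lt (hQ y)).ne'
  rw [Q.extGreen_eq_add_hittingTransform le_rfl x y]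
  refine ENNReal.add_lt_top.mpr ⟨ENNReal.mul_lt_top ?_ ENNReal.ofReal_lt_top,
    ENNReal.mul_lt_top ?_ hyy⟩
  · by_cases h : x ∈ ({y} : Set S) <;> simp [h]
  · exact (Q.lintegral_discountFactor_le_one le_rfl x _).trans_lt ENNReal.one_lt_top

/-- Dominated convergence with majorant `p(t;x,y)`, integrable because `extGreen 0` is finite. It
gives the `limUnder` in `green` its meaning at `0`. -/
lemma Transient.tendsto_integral (hQ : Q.Transient) (x y : S) :
    Tendsto (fun r => ∫ t in Ioi (0 : ℝ), Real.exp (-(r * t)) * Q.transProb t x y) (𝓝[>] 0)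
      (𝓝 (Q.extGreen 0 x y).toReal) := by
  have hp : Measurable fun t => Q.transProb t x y :=
    (Q.measurable_law_stateEvent x y).ennreal_toReal
  have hfin := hQ.extGreen_zero_lt_top x y
  rw [← integral_exp_mul_transProb]
  refine tendsto_integral_filter_of_dominated_convergence (fun t => Q.transProb t x y)
    (Eventually.of_forall fun r => (Measurable.mul (by fun_prop) hp).aestronglyMeasurable) ?_ ?_ ?_
  · filter_upwards [self_mem_nhdsWithin] with r hr
    refine (ae_restrict_iff' measurableSet_Ioi).mpr (Eventually.of_forall fun t ht => ?_)
    have hpos : 0 ≤ Q.transProb t x y := measureReal_nonneg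
    rw [Real.norm_of_nonneg (mul_nonneg (Real.exp_pos _).le hpos)]
    refine mul_le_of_le_one_left hpos ?_
    rw [Real.exp_le_one_iff, neg_nonpos]
    exact (mul_pos hr ht).le
  · refine ⟨hp.aestronglyMeasurable, ?_⟩
    have hnn : ∀ t, 0 ≤ Q.transProb t x y := fun t => measureReal_nonneg
    rw [hasFiniteIntegral_iff_ofReal (Eventually.of_forall hnn)]
    simpa [extGreen, transProb, ofReal_measureReal] using hfin
  · refine Eventually.of_forall fun t => ?_
    have : Continuous fun r => Real.exp (-(r * t)) * Q.transProb t x y := by fun_prop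
    exact (this.tendsto 0).mono_left nhdsWithin_le_nhds

lemma Transient.green_zero (hQ : Q.Transient) (x y : S) : Q.green 0 x y = (Q.extGreen 0 x y).toReal := by
  rw [green, if_neg (lt_irrefl _)]
  exact (hQ.tendsto_integral x y).limUnder_eq

lemma Transient.tendsto_green (hQ : Q.Transient) (x y : S) :
    Tendsto (fun lam => Q.green lam x y) (𝓝[>] 0) (𝓝 (Q.green 0 x y)) := by
  rw [hQ.green_zero]
  refine (hQ.tendsto_integral x y).congr' ?_
  filter_upwards [self_mem_nhdsWithin] with r hr
  rw [green, if_pos (mem_Ioi.mp hr)]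

end Transient

end QMatrix

/-! ### Determinant identities between the three matrices. -/

section MatrixAlgebra

variable {N : ℕ} {lam : ℝ} {q g a b : Fin N → ℝ} {T F G D Dt Dh : Matrix (Fin N) (Fin N) ℝ}

/-- The algebraic relations between the three matrices, with `a = α f' g` and `b = (1 - α) g`. -/
lemma det_eq_zero_iff_of_firstEntrance (hq : ∀ i, 0 < q i) (hlam : 0 ≤ lam)
    (hT : ∀ i j, G i j = (if i = j then 1 / (q j + lam) else 0)
      + q i / (q i + lam) * ∑ k, T i k * G k j)
    (hF : ∀ i j, G i j = (if i = j then 1 / (q j + lam) else 0) + F i j * G j j)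
    (hD : ∀ i j, D i j = (if i = j then a i else 0) + b i * T i j)
    (hDt : ∀ i j, Dt i j = (a i - 1 + b i * ((lam + q i) / q i)) * F i j
      + if i = j then (a i - 1) * (1 - F i i) else 0)
    (hDh : ∀ i j, Dh i j = (a i - 1 + b i * ((lam + q i) / q i)) * G i j
      - if i = j then b i / q i else 0) :
    ((D - 1).det = 0 ↔ Dt.det = 0) ∧ ((D - 1).det = 0 ↔ Dh.det = 0) := by
  have hql : ∀ i, q i + lam ≠ 0 := fun i => (add_pos_of_pos_of_nonneg (hq i) hlam).ne'
  have hq' : ∀ i, q i ≠ 0 := fun i => (hq i).ne'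
  have hTG : ∀ i j, ∑ k, T i k * G k j = (q i + lam) / q i * G i j
      - if i = j then 1 / q i else 0 := by
    intro i j
    have h := hT i j
    have h1 := hql i
    have h2 := hq' i
    split_ifs at h ⊢ with hij
    · subst hij
      rw [h]; field_simp; ring
    · rw [h]; field_simp; ring
  -- In matrix form `hT` exhibits `G` as a factor of an invertible diagonal matrix.
  have hGdet : G.det ≠ 0 := by
    have hprod : (1 - Matrix.of fun i k => q i / (q i + lam) * T i k) * G
        = Matrix.diagonal fun i => 1 / (q i + lam) := by
      ext i j
      have h := hT i j
      rw [sub_mul, one_mul, Matrix.sub_apply, Matrix.mul_apply, Matrix.diagonal_apply]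
      simp only [Matrix.of_apply, mul_assoc, ← Finset.mul_sum]
      rw [h]
      split_ifs with hij
      · subst hij; ring
      · ring
    intro h0
    have h := congrArg Matrix.det hprod
    rw [Matrix.det_mul, h0, mul_zero, Matrix.det_diagonal, eq_comm, Finset.prod_eq_zero_iff] at h
    obtain ⟨i, -, hi⟩ := h
    exact one_div_ne_zero (hql i) hi
  have hGdiag : ∀ j, G j j ≠ 0 := by
    intro j h0
    have h := hF j j
    rw [h0, if_pos rfl, mul_zero, add_zero] at h
    exact one_div_ne_zero (hql j) h.symm
  have hDG : (D - 1) * G = Dh := by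
    ext i j
    rw [sub_mul, one_mul, Matrix.sub_apply, Matrix.mul_apply, hDh]
    simp only [hD, add_mul, Finset.sum_add_distrib, ite_mul, zero_mul, Finset.sum_ite_eq,
      Finset.mem_univ, if_true, mul_assoc, ← Finset.mul_sum, hTG]
    split_ifs <;> ring
  have hDtG : Dt * Matrix.diagonal (fun j => G j j) = Dh := by
    ext i j
    rw [Matrix.mul_diagonal, hDt, hDh]
    have h := hF i j
    have h1 := hql i
    have h2 := hq' i
    split_ifs at h ⊢ with hij
    · subst hij
      -- On the diagonal the extra term of `Dt` completes `(a - 1) F G` to `(a - 1) G`, while the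
      -- `b` part leaves the correction `-b/q`.
      have hFG : F i i * G i i = G i i - 1 / (q i + lam) := by linarith
      linear_combination (b i * ((lam + q i) / q i)) * hFG
        - b i / q i * (mul_one_div_cancel h1)
    · rw [h]; ring
  have hdiag : (Matrix.diagonal fun j => G j j).det ≠ 0 := by
    rw [Matrix.det_diagonal]
    exact Finset.prod_ne_zero_iff.mpr fun j _ => hGdiag j
  have e1 : (D - 1).det = 0 ↔ Dh.det = 0 := by
    rw [← hDG, Matrix.det_mul, mul_eq_zero, or_iff_left hGdet]
  have e2 : Dt.det = 0 ↔ Dh.det = 0 := by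
    rw [← hDtG, Matrix.det_mul, mul_eq_zero, or_iff_left hdiag]
  exact ⟨e1.trans e2.symm, e1⟩

end MatrixAlgebra

/-! ### Both entrance relations for the branching process. -/

namespace CBP

variable {S : Type*} {N : ℕ} [Countable S] [MeasurableSpace S] [DiscreteMeasurableSpace S]
  (C : CBP S N)

lemma tabooFbarStar_eq (i j : Fin N) (lam : ℝ) :
    C.tabooFbarStar i j lam = (∫⁻ ω, discountFactor lam
      (C.Q.exitHittingTime (C.tabooSet j) (C.w j) ω) ∂C.Q.law (C.w i)).toReal :=
  laplaceStieltjes_improperLaw _ (C.Q.measurable_exitHittingTime _ _) _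

lemma Fstar_eq (i j : Fin N) (lam : ℝ) :
    C.Fstar i j lam = (C.Q.hittingTransform lam (C.w i) (C.w j)).toReal :=
  laplaceStieltjes_improperLaw _ (C.Q.measurable_hittingTime _ _) _

/-- The taboo set together with its target is all of `W`, so the killed weights are the same for
every column `j`. -/
lemma lintegral_discountFactor_tabooSet (i j : Fin N) {lam : ℝ} (hlam : 0 ≤ lam) :
    ∫⁻ ω, discountFactor lam (C.Q.exitHittingTime (C.tabooSet j) (C.w j) ω) ∂C.Q.law (C.w i)
      = C.Q.innerPathSum ((range C.w)ᶜ.indicator (C.Q.sojournTransform lam)) (C.w i) (C.w j) := by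
  rw [C.Q.lintegral_discountFactor_exitHittingTime _ _ _ hlam, tabooSet, insert_sdiff_singleton,
    insert_eq_of_mem (mem_range_self j)]

/-- Treats `lam > 0` and the transient case `lam = 0` at once: finiteness lets the identities in
`[0,∞]` pass to real numbers. -/
lemma det_eq_zero_iff {lam : ℝ} (hlam : 0 ≤ lam)
    (hG : ∀ x y, C.Q.green lam x y = (C.Q.extGreen lam x y).toReal)
    (hfin : ∀ x y, C.Q.extGreen lam x y < ∞) :
    ((C.D lam - 1).det = 0 ↔ (C.Dtilde lam).det = 0) ∧
      ((C.D lam - 1).det = 0 ↔ (C.Dhat lam).det = 0) := by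
  have hind : ∀ i j, ((({C.w j} : Set S).indicator 1 (C.w i) : ℝ≥0∞)
      * ENNReal.ofReal (1 / (C.Q.rate (C.w j) + lam))).toReal
      = if i = j then 1 / (C.Q.rate (C.w j) + lam) else 0 := by
    intro i j
    have hq := C.Q.rate_pos (C.w j)
    split_ifs with h
    · subst h
      have : 0 ≤ 1 / (C.Q.rate (C.w i) + lam) := by positivity
      simp only [mem_singleton_iff, indicator_of_mem, Pi.one_apply, one_mul,
        ENNReal.toReal_ofReal this]
    · have : C.w i ≠ C.w j := C.w_injective.ne h
      simp [this]
  have hindfin : ∀ i j, (({C.w j} : Set S).indicator 1 (C.w i) : ℝ≥0∞)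
      * ENNReal.ofReal (1 / (C.Q.rate (C.w j) + lam)) ≠ ∞ := by
    intro i j
    refine ENNReal.mul_ne_top ?_ ENNReal.ofReal_ne_top
    by_cases h : C.w i ∈ ({C.w j} : Set S) <;> simp [h]
  refine det_eq_zero_iff_of_firstEntrance (lam := lam) (q := fun i => C.Q.rate (C.w i))
    (a := fun i => C.α i * C.meanOffspring i * C.Gstar i lam)
    (b := fun i => (1 - C.α i) * C.Gstar i lam)
    (T := Matrix.of fun i j => C.tabooFbarStar i j lam)
    (F := Matrix.of fun i j => C.Fstar i j lam)
    (G := Matrix.of fun i j => C.Q.green lam (C.w i) (C.w j))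
    (fun i => C.Q.rate_pos _) hlam ?_ ?_ ?_ ?_ ?_
  · intro i j
    have hT1 : ∀ k, C.Q.innerPathSum ((range C.w)ᶜ.indicator (C.Q.sojournTransform lam))
        (C.w i) (C.w k) ≠ ∞ := by
      intro k
      rw [← lintegral_discountFactor_tabooSet _ _ _ hlam]
      exact ((C.Q.lintegral_discountFactor_le_one hlam _ _).trans_lt ENNReal.one_lt_top).ne
    have hterm : ∀ k, C.Q.innerPathSum ((range C.w)ᶜ.indicator (C.Q.sojournTransform lam))
        (C.w i) (C.w k) * C.Q.extGreen lam (C.w k) (C.w j) ≠ ∞ := fun k =>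
      ENNReal.mul_ne_top (hT1 k) (hfin _ _).ne
    have hsoj : C.Q.sojournTransform lam (C.w i) ≠ ∞ := ENNReal.ofReal_ne_top
    have hq := C.Q.rate_pos (C.w i)
    simp only [Matrix.of_apply, hG, tabooFbarStar_eq, lintegral_discountFactor_tabooSet _ _ _ hlam]
    rw [C.Q.extGreen_eq_add_sum hlam C.w C.w_injective (C.w i) j, ENNReal.toReal_add (hindfin i j)
      (ENNReal.mul_ne_top hsoj (ENNReal.sum_ne_top.mpr fun k _ => hterm k)), hind,
      ENNReal.toReal_mul, ENNReal.toReal_sum fun k _ => hterm k, QMatrix.sojournTransform,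
      ENNReal.toReal_ofReal (by positivity)]
    simp only [ENNReal.toReal_mul]
  · intro i j
    have h1 : C.Q.hittingTransform lam (C.w i) (C.w j) ≠ ∞ :=
      ((C.Q.lintegral_discountFactor_le_one hlam _ _).trans_lt ENNReal.one_lt_top).ne
    simp only [Matrix.of_apply, hG, Fstar_eq]
    rw [C.Q.extGreen_eq_add_hittingTransform hlam (C.w i) (C.w j), ENNReal.toReal_add (hindfin i j)
      (ENNReal.mul_ne_top h1 (hfin _ _).ne), hind, ENNReal.toReal_mul]
  · intro i j
    rfl
  · intro i j
    simp only [Dtilde, Matrix.of_apply, rowCoeff, QMatrix.rate, sub_eq_add_neg]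
  · intro i j
    simp only [Dhat, Matrix.of_apply, rowCoeff, QMatrix.rate, sub_eq_add_neg]
    congr 1
    split_ifs
    · have := (C.Q.diag_neg (C.w i)).ne
      field_simp
    · simp

end CBP

/-! ### Strict domination excludes the eigenvalue `1`. -/

section Perron

attribute [local instance] Matrix.linftyOpNormedAddCommGroup Matrix.linftyOpNormedRing
  Matrix.linftyOpNormedAlgebra

lemma spectralRadius_le_one_of_hasEigenvalue {N : ℕ} {B : Matrix (Fin N) (Fin N) ℂ}
    (h : ∀ μ : ℂ, Module.End.HasEigenvalue (Matrix.toLin' B) μ → ‖μ‖ ≤ 1) :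
    spectralRadius ℂ B ≤ 1 := by
  refine iSup₂_le fun μ hμ => ?_
  rw [← Matrix.spectrum_toLin', ← Module.End.hasEigenvalue_iff_mem_spectrum] at hμ
  exact_mod_cast h μ hμ

lemma tendsto_pow_mul_norm_pow {N : ℕ} {B : Matrix (Fin N) (Fin N) ℂ}
    (hB : spectralRadius ℂ B ≤ 1) {κ : ℝ} (hκ0 : 0 < κ) (hκ1 : κ < 1) :
    Tendsto (fun n => κ ^ n * ‖B ^ n‖) atTop (𝓝 0) := by
  -- With `1 < θ < 1/κ`, Gelfand's formula gives `‖B^n‖ ≤ θ^n` eventually, while `κθ < 1`.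
  obtain ⟨θ, hθ1, hθ2⟩ := exists_between ((one_lt_inv₀ hκ0).mpr hκ1)
  have hθ0 : 0 < θ := one_pos.trans hθ1
  have hlim := spectrum.pow_norm_pow_one_div_tendsto_nhds_spectralRadius B
  have hlt : spectralRadius ℂ B < ENNReal.ofReal θ :=
    hB.trans_lt (by rwa [ENNReal.one_lt_ofReal])
  have hev := hlim.eventually_lt_const hlt
  have hκθ : κ * θ < 1 := by
    rw [lt_inv_comm₀ hθ0 hκ0] at hθ2
    calc κ * θ < θ⁻¹ * θ := by gcongr
      _ = 1 := inv_mul_cancel₀ hθ0.ne'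
  refine squeeze_zero' (Eventually.of_forall fun n => by positivity) ?_
    (tendsto_pow_atTop_nhds_zero_of_lt_one (by positivity) hκθ)
  filter_upwards [hev, eventually_gt_atTop 0] with n hn hn0
  rw [ENNReal.ofReal_lt_ofReal_iff hθ0] at hn
  rw [mul_pow]
  gcongr
  have h1 := pow_le_pow_left₀ (by positivity) hn.le n
  rwa [← Real.rpow_natCast, ← Real.rpow_mul (norm_nonneg _), one_div,
    inv_mul_cancel₀ (by exact_mod_cast hn0.ne'), Real.rpow_one] at h1

/-- A nonnegative matrix strictly dominated by a matrix of spectral radius at most `1` does not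
have the eigenvalue `1`. -/
lemma det_sub_one_ne_zero_of_le_smul {N : ℕ} {A B : Matrix (Fin N) (Fin N) ℝ} {κ : ℝ}
    (hκ0 : 0 < κ) (hκ1 : κ < 1) (hA : ∀ i j, 0 ≤ A i j) (hAB : ∀ i j, A i j ≤ κ * B i j)
    (hB : ∀ μ : ℂ,
      Module.End.HasEigenvalue (Matrix.toLin' (B.map (algebraMap ℝ ℂ))) μ → ‖μ‖ ≤ 1) :
    (A - 1).det ≠ 0 := by
  intro hdet
  obtain ⟨v, hv0, hv⟩ := Matrix.exists_mulVec_eq_zero_iff.mpr hdet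
  rw [Matrix.sub_mulVec, Matrix.one_mulVec, sub_eq_zero] at hv
  -- For a fixed vector `v` of `A`, `u = |v|` satisfies `u ≤ κ B u`. As `B ≥ 0`, iteration gives `u
  -- ≤ κ^n B^n u`, which tends to `0`, so `v = 0`.
  set u : Fin N → ℝ := fun i => |v i| with hu
  have hstep : ∀ i, u i ≤ κ * (B.mulVec u) i := by
    intro i
    calc u i = |∑ j, A i j * v j| := by rw [hu]; exact congrArg abs (congrFun hv i).symm
      _ ≤ ∑ j, |A i j * v j| := Finset.abs_sum_le_sum_abs _ _
      _ = ∑ j, A i j * u j := Finset.sum_congr rfl fun j _ => by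
          rw [abs_mul, abs_of_nonneg (hA i j)]
      _ ≤ ∑ j, κ * (B i j * u j) := Finset.sum_le_sum fun j _ => by
          rw [← mul_assoc]
          exact mul_le_mul_of_nonneg_right (hAB i j) (abs_nonneg _)
      _ = κ * (B.mulVec u) i := by rw [← Finset.mul_sum]; rfl
  have hB0 : ∀ i j, 0 ≤ B i j := fun i j =>
    nonneg_of_mul_nonneg_right ((hA i j).trans (hAB i j)) hκ0
  have hpow : ∀ n i, u i ≤ κ ^ n * ((B ^ n).mulVec u) i := by
    intro n
    induction n with
    | zero => simp
    | succ n ih =>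
      intro i
      have h1 : (B.mulVec u) i ≤ κ ^ n * ((B ^ (n + 1)).mulVec u) i := by
        rw [pow_succ', ← Matrix.mulVec_mulVec]
        simp only [Matrix.mulVec, dotProduct]
        rw [Finset.mul_sum]
        refine Finset.sum_le_sum fun j _ => ?_
        rw [mul_left_comm]
        exact mul_le_mul_of_nonneg_left (ih j) (hB0 i j)
      calc u i ≤ κ * (B.mulVec u) i := hstep i
        _ ≤ κ * (κ ^ n * ((B ^ (n + 1)).mulVec u) i) := by gcongr
        _ = κ ^ (n + 1) * ((B ^ (n + 1)).mulVec u) i := by ring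
  have hlim := (tendsto_pow_mul_norm_pow (spectralRadius_le_one_of_hasEigenvalue hB)
    hκ0 hκ1).mul_const ‖fun i => (u i : ℂ)‖
  rw [zero_mul] at hlim
  apply hv0
  funext i
  have hle : u i ≤ 0 := by
    refine ge_of_tendsto' hlim fun n => (hpow n i).trans ?_
    rw [mul_assoc]
    gcongr
    have h2 : (((B ^ n).mulVec u i : ℝ) : ℂ)
        = (((B.map (algebraMap ℝ ℂ)) ^ n).mulVec fun i => (u i : ℂ)) i := by
      rw [← Matrix.map_pow]
      simp [Matrix.mulVec, dotProduct]
    calc (B ^ n).mulVec u i ≤ ‖(((B ^ n).mulVec u i : ℝ) : ℂ)‖ := by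
          rw [Complex.norm_real]; exact le_abs_self _
      _ ≤ ‖((B.map (algebraMap ℝ ℂ)) ^ n).mulVec fun i => (u i : ℂ)‖ := by
          rw [h2]; exact norm_le_pi_norm _ i
      _ ≤ _ := Matrix.linfty_opNorm_mulVec _ _
  exact abs_eq_zero.mp (le_antisymm hle (abs_nonneg _))

end Perron

/-! ### Monotonicity of `D` and the Malthusian parameter. -/

namespace CBP

variable {S : Type*} {N : ℕ} (C : CBP S N)

lemma meanOffspring_nonneg (i : Fin N) : 0 ≤ C.meanOffspring i := by
  refine MonotoneOn.derivWithin_nonneg fun s hs t ht hst => ?_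
  have hsum : Summable fun n => (C.ξ i n).toReal :=
    ENNReal.summable_toReal (C.ξ i).tsum_coe_ne_top
  have hs' : ∀ r ∈ Icc (0 : ℝ) 1, Summable fun n => (C.ξ i n).toReal * r ^ n := fun r hr =>
    hsum.of_nonneg_of_le (fun n => mul_nonneg ENNReal.toReal_nonneg (pow_nonneg hr.1 n))
      fun n => mul_le_of_le_one_right ENNReal.toReal_nonneg (pow_le_one₀ hr.1 hr.2)
  refine (hs' s hs).tsum_le_tsum (fun n => ?_) (hs' t ht)
  have := hs.1
  gcongr

lemma Gstar_eq (i : Fin N) {lam : ℝ} (hlam : 0 ≤ lam) :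
    C.Gstar i lam = C.β i / (C.β i + lam) := by
  have hβ := C.β_pos i
  rw [Gstar, laplaceStieltjes, integral_eq_lintegral_of_nonneg_ae
    (Eventually.of_forall fun _ => (Real.exp_pos _).le) (by fun_prop),
    lintegral_exp_expMeasure hβ hlam, ENNReal.toReal_ofReal (by positivity)]

variable [Countable S] [MeasurableSpace S] [DiscreteMeasurableSpace S]

lemma tabooFbarStar_nonneg (i j : Fin N) (lam : ℝ) : 0 ≤ C.tabooFbarStar i j lam := by
  rw [tabooFbarStar_eq]; exact ENNReal.toReal_nonneg

lemma tabooFbarStar_anti (i j : Fin N) {lam mu : ℝ} (h0 : 0 ≤ lam) (h : lam ≤ mu) :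
    C.tabooFbarStar i j mu ≤ C.tabooFbarStar i j lam := by
  simp only [tabooFbarStar_eq]
  refine ENNReal.toReal_mono ?_ (lintegral_mono fun ω => QMatrix.discountFactor_anti h _)
  exact ((C.Q.lintegral_discountFactor_le_one h0 _ _).trans_lt ENNReal.one_lt_top).ne

/-- Isolates the strictly decreasing factor of row `i`; the bracket is nonnegative and nonincreasing
on `lam ≥ 0`. -/
lemma D_apply (i j : Fin N) (lam : ℝ) : C.D lam i j = C.Gstar i lam
    * ((if i = j then C.α i * C.meanOffspring i else 0)
      + (1 - C.α i) * C.tabooFbarStar i j lam) := by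
  simp only [D, Matrix.of_apply]
  split_ifs <;> ring

lemma IsMalthusian.det_D_eq_zero {C : CBP S N} {ν : ℝ} (h : C.IsMalthusian ν) :
    (C.D ν - 1).det = 0 := by
  obtain ⟨v, hv⟩ := h.2.1.exists_hasEigenvector
  refine Matrix.exists_mulVec_eq_zero_iff.mp ⟨v, hv.2, ?_⟩
  have := hv.apply_eq_smul
  rw [Matrix.toLin'_apply, one_smul] at this
  rw [Matrix.sub_mulVec, Matrix.one_mulVec, this, sub_self]

lemma IsMalthusian.det_D_ne_zero {C : CBP S N} {ν lam : ℝ} (h : C.IsMalthusian ν)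
    (hlam : ν < lam) : (C.D lam - 1).det ≠ 0 := by
  have hν := h.1
  have hlam0 : 0 < lam := hν.trans hlam
  -- The ratios of `Gstar` at `lam` and at `ν` are finitely many numbers below `1`, so any `κ < 1`
  -- close enough to `1` dominates them all.
  obtain ⟨κ, hκ, hκ0, hκ1⟩ : ∃ κ : ℝ,
      (∀ i, (C.β i + ν) / (C.β i + lam) ≤ κ) ∧ 0 < κ ∧ κ < 1 := by
    have h1 : ∀ᶠ κ in 𝓝[<] (1 : ℝ), ∀ i, (C.β i + ν) / (C.β i + lam) ≤ κ := by
      refine eventually_all.mpr fun i => ?_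
      have hβ := C.β_pos i
      have : (C.β i + ν) / (C.β i + lam) < 1 := by
        rw [div_lt_one (by positivity)]; linarith
      exact (eventually_ge_nhds this).filter_mono nhdsWithin_le_nhds
    have h2 : ∀ᶠ κ in 𝓝[<] (1 : ℝ), 0 < κ :=
      (eventually_gt_nhds one_pos).filter_mono nhdsWithin_le_nhds
    exact (h1.and (h2.and self_mem_nhdsWithin)).exists
  have hin : ∀ i j mu, 0 ≤ (if i = j then C.α i * C.meanOffspring i else 0)
      + (1 - C.α i) * C.tabooFbarStar i j mu := by
    intro i j mu
    refine add_nonneg ?_ (mul_nonneg (by linarith [C.α_lt_one i]) (C.tabooFbarStar_nonneg i j mu))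
    split_ifs
    · exact mul_nonneg (C.α_nonneg i) (C.meanOffspring_nonneg i)
    · exact le_rfl
  refine det_sub_one_ne_zero_of_le_smul hκ0 hκ1 (B := C.D ν) (fun i j => ?_) (fun i j => ?_)
    h.2.2
  · have hβ := C.β_pos i
    rw [D_apply, C.Gstar_eq i hlam0.le]
    exact mul_nonneg (by positivity) (hin i j lam)
  · have hβ := C.β_pos i
    rw [D_apply, D_apply, C.Gstar_eq i hlam0.le, C.Gstar_eq i hν.le, ← mul_assoc]
    refine mul_le_mul ?_ ?_ (hin i j lam) (by positivity)
    · calc C.β i / (C.β i + lam)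
          = (C.β i + ν) / (C.β i + lam) * (C.β i / (C.β i + ν)) := by field_simp
        _ ≤ κ * (C.β i / (C.β i + ν)) := by gcongr; exact hκ i
    · have := C.tabooFbarStar_anti i j hν.le hlam.le
      have h1 : 0 ≤ 1 - C.α i := by linarith [C.α_lt_one i]
      gcongr

end CBP

theorem lemma5 {S : Type*} [Countable S] [MeasurableSpace S] [DiscreteMeasurableSpace S] {N : ℕ}
    (C : CBP S N) (hirr : C.Q.Irreducible) :
    (∀ lam : ℝ, 0 < lam →
      (((C.D lam - 1).det = 0 ↔ (C.Dtilde lam).det = 0) ∧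
        ((C.D lam - 1).det = 0 ↔ (C.Dhat lam).det = 0))) ∧
    (C.Q.Transient →
      (∀ x y : S, Tendsto (fun lam => C.Q.green lam x y) (𝓝[>] 0) (𝓝 (C.Q.green 0 x y))) ∧
      ((C.D 0 - 1).det = 0 ↔ (C.Dtilde 0).det = 0) ∧
      ((C.D 0 - 1).det = 0 ↔ (C.Dhat 0).det = 0)) ∧
    (∀ ν : ℝ, C.IsMalthusian ν →
      IsGreatest {lam : ℝ | 0 < lam ∧ (C.Dtilde lam).det = 0} ν ∧
      IsGreatest {lam : ℝ | 0 < lam ∧ (C.Dhat lam).det = 0} ν) := by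
  have hpos : ∀ lam : ℝ, 0 < lam →
      (((C.D lam - 1).det = 0 ↔ (C.Dtilde lam).det = 0) ∧
        ((C.D lam - 1).det = 0 ↔ (C.Dhat lam).det = 0)) := fun lam hlam =>
    C.det_eq_zero_iff hlam.le (C.Q.green_of_pos hlam) (C.Q.extGreen_lt_top hlam)
  refine ⟨hpos, fun htr => ⟨htr.tendsto_green,
    C.det_eq_zero_iff le_rfl htr.green_zero htr.extGreen_zero_lt_top⟩, fun ν hν => ⟨⟨⟨hν.1,
      (hpos ν hν.1).1.mp hν.det_D_eq_zero⟩, fun lam hlam => ?_⟩, ⟨⟨hν.1,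
      (hpos ν hν.1).2.mp hν.det_D_eq_zero⟩, fun lam hlam => ?_⟩⟩⟩
  · exact not_lt.mp fun h => hν.det_D_ne_zero h ((hpos lam hlam.1).1.mpr hlam.2)
  · exact not_lt.mp fun h => hν.det_D_ne_zero h ((hpos lam hlam.1).2.mpr hlam.2)
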